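/- **Setting.** Let $n$ be a prime with $n\equiv 1\pmod 8$, let $p$ be a prime with $\frac{n-1}{4}\equiv 0\pmod p$, let $q$ be a power of $p$, and write $n=u^2+4v^2$ with integers $u,v$, $u\equiv 1\pmod 4$. Fix a generator $g$ of $\mathrm{GF}(n)^*$, put $C_i=C_i^{(4,n)}=g^i\langle g^4\rangle$ for $0\le i\le 3$, and assume $q\in C_0$. Let $\eta$ be a primitive $n$-th root of unity in an extension field of $\mathrm{GF}(q)$, and put $\Omega_i(x)=\Omega_i^{(4,n)}(x)=\prod_{j\in C_i}(x-\eta^j)$ and $\eta_i=\sum_{j\in C_i}\eta^j$; assume that $\eta$ is chosen such that $\eta_0+\eta_2=0$. For $\rho\in\{0,1\}$ let $\lambda^\infty=(\lambda_i)_{i\ge 0}$ be the sequence of period $n$ over $\mathrm{GF}(q)$ with $\lambda_i=\rho$ if $n\mid i$, $\lambda_i=0$ if $i \bmod n\in C_0$, and $\lambda_i=1$ otherwise. **Conventions.** A characteristic polynomial of $\lambda^\infty$ is a polynomial $c=c_0+c_1x+\dots+c_\ell x^\ell$ with $c_0=1$ such that $\sum_{j=0}^{\ell}c_j\lambda_{i-j}=0$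 for all $i\ge\ell$ (here $c_\ell=0$ is allowed). The linear span $\mathbb L_\lambda$ is the smallest $\ell$ for which there is one; the minimal polynomial is the characteristic polynomial of least degree. The code $\mathcal C_\lambda$ is the cyclic code of length $n$ over $\mathrm{GF}(q)$ generated by $(x^n-1)/\gcd(\Lambda(x),x^n-1)$, $\Lambda(x)=\sum_{i=0}^{n-1}\lambda_ix^i$. In every case below the following is asserted for the monic polynomial $m_\lambda(x)$ given there: $m_\lambda\in\mathrm{GF}(q)[x]$; the minimal polynomial of $\lambda^\infty$ is unique and equals $m_\lambda(0)^{-1}m_\lambda(x)$; $\mathbb L_\lambda$ has the value given; the generator polynomial of $\mathcal C_\lambda$ is $m_\lambda(x)$, and $\dim\mathcal C_\lambda=n-\mathbb L_\lambda$. By $d$ we denote the minimum Hamming weight of the nonzero codewords of $\mathcal C_\lambda$, by $d_{odd}$ the minimum weight of its odd-like codewords (those whose coordinate sum is nonzero). With $r=q^{(n-1)/4}$, $N=\frac{r-1}{n}$ and $N_1=\frac{N}{q-1}$ put $$B_1=(q-1)\left\lceil\frac{r-\lfloor (N_1-1)\sqrt r\rfloor}{qN}\right\rceil,\qquad B_2=\frac{(q-1)(r-1)-1}{qN}-\frac{q-1}{q}\left\lfloor\frac{(N-1)\sqrt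 r}{N}\right\rfloor .$$ Write $E=\frac{n+1-2u}{16}$ and $C=\frac{n-3+2u}{16}$ (these are integers), and let $\mathrm{ord}_n(q)$ be the multiplicative order of $q$ modulo $n$. **Theorem.** 1. If $E\equiv 0$ and $C\equiv 0\pmod p$, then $\eta_1\in\{0,-1\}$, and - if $\rho=0$: $m_\lambda=\frac{x^n-1}{(x-1)\Omega_3}$ when $\eta_1=0$, $m_\lambda=\frac{x^n-1}{(x-1)\Omega_1}$ when $\eta_1=-1$, and $\mathbb L_\lambda=n-\frac{n+3}{4}$; moreover $d\ge B_2$ provided that $\mathrm{ord}_n(q)=(n-1)/4$; - if $\rho=1$: $m_\lambda=\frac{x^n-1}{\Omega_1\Omega_0\Omega_2}$ when $\eta_1=0$, $m_\lambda=\frac{x^n-1}{\Omega_3\Omega_0\Omega_2}$ when $\eta_1=-1$, and $\mathbb L_\lambda=n-\frac{3n-3}{4}$. 2. If $E\equiv 0$ and $C\not\equiv 0\pmod p$, then - if $\rho=0$: $m_\lambda=\frac{x^n-1}{x-1}$, $\mathbb L_\lambda=n-1$ and $d=n$; - if $\rho=1$: $m_\lambda=\frac{x^n-1}{\Omega_0\Omega_2}$,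 $\mathbb L_\lambda=n-\frac{n-1}{2}$ and $d\ge\sqrt n$. 3. If $E\equiv 1$ and $C\equiv 0\pmod p$, then $\eta_1\in\{0,-1\}$, and - if $\rho=1$: $m_\lambda=\frac{x^n-1}{\Omega_1}$ when $\eta_1=0$, $m_\lambda=\frac{x^n-1}{\Omega_3}$ when $\eta_1=-1$, and $\mathbb L_\lambda=n-\frac{n-1}{4}$; moreover $d\ge B_1$ provided that $\mathrm{ord}_n(q)=(n-1)/4$; - if $\rho=0$ and $p$ is odd: $\eta_0\in\{1,-1\}$, $m_\lambda=\frac{x^n-1}{(x-1)\Omega_i\Omega_j}$ with $i=3$ when $\eta_1=0$, $i=1$ when $\eta_1=-1$, $j=2$ when $\eta_0=1$, $j=0$ when $\eta_0=-1$, and $\mathbb L_\lambda=n-\frac{n+1}{2}$; moreover $\mathcal C_\lambda$ is a duadic code and $d_{odd}\ge\sqrt n$; - if $\rho=0$ and $p=2$: $m_\lambda=\frac{x^n-1}{(x-1)\Omega_3\Omega_0\Omega_2}$ when $\eta_1=0$, $m_\lambda=\frac{x^n-1}{(x-1)\Omega_1\Omega_0\Omega_2}$ when $\eta_1=-1$,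 and $\mathbb L_\lambda=n-\frac{3n+1}{4}$. 4. If $E\equiv 1$ and $C\not\equiv 0\pmod p$, then - if $\rho=0$ and $p$ is odd: $\eta_0\in\{1,-1\}$, $m_\lambda=\frac{x^n-1}{(x-1)\Omega_2}$ when $\eta_0=1$, $m_\lambda=\frac{x^n-1}{(x-1)\Omega_0}$ when $\eta_0=-1$, and $\mathbb L_\lambda=n-\frac{n+3}{4}$; moreover $d\ge B_2$ provided that $\mathrm{ord}_n(q)=(n-1)/4$; - if $\rho=0$ and $p=2$: $m_\lambda=\frac{x^n-1}{(x-1)\Omega_0\Omega_2}$, $\mathbb L_\lambda=n-\frac{n+1}{2}$, $\mathcal C_\lambda$ is a quadratic residue code, and $d\ge\sqrt n$; - if $\rho=1$: $m_\lambda=x^n-1$ and $\mathbb L_\lambda=n$ (so $\mathcal C_\lambda$ is the zero code). 5. If $E\not\equiv 0,1$ and $C\equiv 0\pmod p$, then $\eta_1\in\{0,-1\}$, and - if $\rho=0$: $m_\lambda=\frac{x^n-1}{(x-1)\Omega_3}$ when $\eta_1=0$, $m_\lambda=\frac{x^n-1}{(x-1)\Omega_1}$ when $\eta_1=-1$, and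 $\mathbb L_\lambda=n-\frac{n+3}{4}$; moreover $d\ge B_2$ provided that $\mathrm{ord}_n(q)=(n-1)/4$; - if $\rho=1$: $m_\lambda=\frac{x^n-1}{\Omega_1}$ when $\eta_1=0$, $m_\lambda=\frac{x^n-1}{\Omega_3}$ when $\eta_1=-1$, and $\mathbb L_\lambda=n-\frac{n-1}{4}$; moreover $d\ge B_1$ provided that $\mathrm{ord}_n(q)=(n-1)/4$. 6. If $E\not\equiv 0,1$ and $C\not\equiv 0\pmod p$, then - if $\rho=0$: $m_\lambda=\frac{x^n-1}{x-1}$, $\mathbb L_\lambda=n-1$ and $d=n$; - if $\rho=1$: $m_\lambda=x^n-1$ and $\mathbb L_\lambda=n$ (so $\mathcal C_\lambda$ is the zero code). -/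

import Mathlib

open Polynomial

noncomputable section

/-! ### Feedback polynomials, linear span and minimal polynomial of a sequence -/

/-- The polynomial `c = c_0 + c_1 x + ⋯ + c_ℓ x^ℓ` with `c_0 = 1` is a feedback polynomial of a linear
feedback shift register of length `ℓ` generating `s`:
`- c_0 s_i = c_1 s_{i-1} + ⋯ + c_ℓ s_{i-ℓ}` for all `i ≥ ℓ`. -/
def GeneratesSeq {F : Type*} [Field F] (s : ℕ → F) (l : ℕ) (c : F[X]) : Prop :=
  c.coeff 0 = 1 ∧ c.natDegree ≤ l ∧
    ∀ i : ℕ, l ≤ i → ∑ j ∈ Finset.range (l + 1), c.coeff j * s (i - j) = 0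

/-- `L` is the linear span of `s`. -/
def IsLinearSpan {F : Type*} [Field F] (s : ℕ → F) (L : ℕ) : Prop :=
  IsLeast {l : ℕ | ∃ c : F[X], GeneratesSeq s l c} L

/-- `c` is a characteristic polynomial of `s` (its constant term is `1`). -/
def IsCharPolySeq {F : Type*} [Field F] (s : ℕ → F) (c : F[X]) : Prop :=
  ∃ l : ℕ, GeneratesSeq s l c

/-- `m` is a characteristic polynomial of `s` of smallest degree. -/
def IsMinPolySeq {F : Type*} [Field F] (s : ℕ → F) (m : F[X]) : Prop :=
  IsCharPolySeq s m ∧ ∀ c : F[X], IsCharPolySeq s c → m.natDegree ≤ c.natDegree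

/-! ### Cyclic codes -/

/-- The word `(c_0, …, c_{n-1})` read as the polynomial `c_0 + c_1 x + ⋯ + c_{n-1} x^{n-1}`. -/
def wordPoly (F : Type*) [Field F] (n : ℕ) : (Fin n → F) →ₗ[F] F[X] :=
  ∑ i : Fin n, (Polynomial.monomial (i : ℕ)) ∘ₗ (LinearMap.proj i)

/-- The words of length `n` whose polynomial is a multiple of `g`. For `g ∣ x^n - 1` these are the words
whose polynomials represent the ideal generated by `g` in `F[x]/(x^n - 1)`. -/
def cyclicCode {F : Type*} [Field F] (n : ℕ) (g : F[X]) : Submodule F (Fin n → F) :=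
  ((Ideal.span {g}).restrictScalars F).comap (wordPoly F n)

/-- `g` is the generator polynomial of the cyclic code `C` of length `n`. -/
def IsGeneratorPoly {F : Type*} [Field F] {n : ℕ} (C : Submodule F (Fin n → F)) (g : F[X]) : Prop :=
  g.Monic ∧ g ∣ X ^ n - 1 ∧ C = cyclicCode n g

open Classical in
/-- The code of length `n` defined by a sequence `s` of period `n`: the cyclic code generated by
`(x^n - 1) / gcd(s_0 + s_1 x + ⋯ + s_{n-1} x^{n-1}, x^n - 1)`. -/
def seqCode {F : Type*} [Field F] (n : ℕ) (s : ℕ → F) : Submodule F (Fin n → F) :=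
  cyclicCode n
    ((X ^ n - 1) / EuclideanDomain.gcd (∑ i ∈ Finset.range n, Polynomial.monomial i (s i)) (X ^ n - 1))

open Classical in
/-- `d` is the minimum Hamming weight of the nonzero words of `C`. -/
def IsMinWeight {F : Type*} [Field F] {n : ℕ} (C : Submodule F (Fin n → F)) (d : ℕ) : Prop :=
  IsLeast {w : ℕ | ∃ c ∈ C, c ≠ 0 ∧ hammingNorm c = w} d

open Classical in
/-- `d` is the minimum Hamming weight of the odd-like words of `C`. -/
def IsMinOddLikeWeight {F : Type*} [Field F] {n : ℕ} (C : Submodule F (Fin n → F)) (d : ℕ) : Prop :=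
  IsLeast {w : ℕ | ∃ c ∈ C, ∑ i, c i ≠ 0 ∧ hammingNorm c = w} d

/-- The generator polynomial of `C` is `∏_{s ∈ S} (x - η^s)`. -/
def HasDefiningSet {F K : Type*} [Field F] [Field K] [Algebra F K] {n : ℕ} (η : K)
    (C : Submodule F (Fin n → F)) (S : Finset (ZMod n)) : Prop :=
  ∃ g : F[X], IsGeneratorPoly C g ∧
    g.map (algebraMap F K) = ∏ s ∈ S, (X - Polynomial.C (η ^ s.val))

open Classical in
/-- `C` is one of the four quadratic residue codes of length `n`: its defining set (relative to the
primitive `n`-th root of unity `η`) is the set of nonzero squares or the set of non-squares modulo `n`,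
with or without `0` added. -/
def IsQuadraticResidueCode {F K : Type*} [Field F] [Field K] [Algebra F K] {n : ℕ} [NeZero n] (η : K)
    (C : Submodule F (Fin n → F)) : Prop :=
  ∃ S : Finset (ZMod n),
    (S = Finset.univ.filter (fun x : ZMod n => x ≠ 0 ∧ IsSquare x) ∨
      S = Finset.univ.filter (fun x : ZMod n => ¬ IsSquare x)) ∧
    (HasDefiningSet η C S ∨ HasDefiningSet η C (insert 0 S))

open Classical in
/-- `C` is a duadic code of length `n`: there is a splitting `S₁, S₂` of the nonzero residues into
unions of `q`-cyclotomic cosets interchanged by a multiplier `a`, and the defining set of `C` (relative to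
the primitive `n`-th root of unity `η`) is `S₁`, with or without `0` added. -/
def IsDuadicCode {F K : Type*} [Field F] [Fintype F] [Field K] [Algebra F K] {n : ℕ} [NeZero n] (η : K)
    (C : Submodule F (Fin n → F)) : Prop :=
  ∃ S₁ S₂ : Finset (ZMod n),
    S₁ ∪ S₂ = Finset.univ.erase 0 ∧ Disjoint S₁ S₂ ∧
    (∀ s ∈ S₁, (Fintype.card F : ZMod n) * s ∈ S₁) ∧
    (∀ s ∈ S₂, (Fintype.card F : ZMod n) * s ∈ S₂) ∧
    (∃ a : (ZMod n)ˣ, S₁.image (fun s => (a : ZMod n) * s) = S₂ ∧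
      S₂.image (fun s => (a : ZMod n) * s) = S₁) ∧
    (HasDefiningSet η C S₁ ∨ HasDefiningSet η C (insert 0 S₁))

/-! ### Cyclotomic classes of order four and the sequence they define -/

open Classical in
/-- The cyclotomic class `C_i^{(N,n)} = g^i ⟨g^N⟩` in `ZMod n`, for a generator `g` of `(ZMod n)ˣ`. -/
def cyclotomicClass {n : ℕ} [NeZero n] (N : ℕ) (g : (ZMod n)ˣ) (i : ℕ) : Finset (ZMod n) :=
  Finset.univ.filter
    (fun x : ZMod n => ∃ y ∈ Subgroup.zpowers (g ^ N), x = ((g ^ i * y : (ZMod n)ˣ) : ZMod n))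

/-- `Ω_i^{(4,n)}(x) = ∏_{j ∈ C_i^{(4,n)}} (x - η^j)`. -/
def Omega {n : ℕ} [NeZero n] {K : Type*} [Field K] (g : (ZMod n)ˣ) (η : K) (i : ℕ) : K[X] :=
  ∏ j ∈ cyclotomicClass 4 g i, (X - Polynomial.C (η ^ j.val))

/-- The period `η_i = ∑_{j ∈ C_i^{(4,n)}} η^j`. -/
def etaPeriod {n : ℕ} [NeZero n] {K : Type*} [Field K] (g : (ZMod n)ˣ) (η : K) (i : ℕ) : K :=
  ∑ j ∈ cyclotomicClass 4 g i, η ^ j.val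

open Classical in
/-- The sequence of period `n` that is `ρ` at `0`, `0` on `C_0^{(4,n)}` and `1` on
`C_1^{(4,n)} ∪ C_2^{(4,n)} ∪ C_3^{(4,n)}`. -/
def cycSeq {n : ℕ} [NeZero n] {F : Type*} [Field F] (g : (ZMod n)ˣ) (ρ : F) (i : ℕ) : F :=
  if (i : ZMod n) = 0 then ρ
  else if (i : ZMod n) ∈ cyclotomicClass 4 g 0 then 0 else 1

/-! ### The two weight bounds -/

/-- With `r = q^{(n-1)/4}`, `N = (r-1)/n` and `N₁ = N/(q-1)`:
`(q-1) ⌈(r - ⌊(N₁-1) √r⌋) / (qN)⌉`. -/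
def irreducibleBound (q n : ℕ) : ℝ :=
  let r : ℝ := (q : ℝ) ^ ((n - 1) / 4)
  let N : ℝ := (r - 1) / n
  let N₁ : ℝ := N / ((q : ℝ) - 1)
  ((q : ℝ) - 1) * (⌈(r - (⌊(N₁ - 1) * Real.sqrt r⌋ : ℝ)) / (q * N)⌉ : ℝ)

/-- With `r = q^{(n-1)/4}` and `N = (r-1)/n`:
`((q-1)(r-1) - 1)/(qN) - ((q-1)/q) ⌊(N-1) √r / N⌋`. -/
def augmentedBound (q n : ℕ) : ℝ :=
  let r : ℝ := (q : ℝ) ^ ((n - 1) / 4)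
  let N : ℝ := (r - 1) / n
  (((q : ℝ) - 1) * (r - 1) - 1) / (q * N)
    - ((q : ℝ) - 1) / q * (⌊(N - 1) * Real.sqrt r / N⌋ : ℝ)

/-- `C` has a minimum weight `d`, and `d ≥ b`. -/
def MinWeightGE {F : Type*} [Field F] {n : ℕ} (C : Submodule F (Fin n → F)) (b : ℝ) : Prop :=
  ∃ d : ℕ, IsMinWeight C d ∧ b ≤ (d : ℝ)

/-- `C` has a minimum odd-like weight `d`, and `d ≥ b`. -/
def MinOddLikeWeightGE {F : Type*} [Field F] {n : ℕ} (C : Submodule F (Fin n → F)) (b : ℝ) : Prop :=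
  ∃ d : ℕ, IsMinOddLikeWeight C d ∧ b ≤ (d : ℝ)

/-- The description of a sequence `s` of period `n` and of its code by a divisor `D` of `x^n - 1` over the
extension field `K` and a number `L`: the quotient `M = (x^n - 1)/D` has coefficients in `F`; the minimal
polynomial of `s` is `M`, scaled to constant term `1`; `L` is the linear span of `s`; `M` is the
generator polynomial of the code defined by `s`, and the code has dimension `n - L`. -/
def SeqAndCodeGivenBy {F K : Type*} [Field F] [Field K] [Algebra F K] (n : ℕ) (s : ℕ → F)
    (D : K[X]) (L : ℕ) : Prop :=
  ∃ M : F[X], M.map (algebraMap F K) * D = X ^ n - 1 ∧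
    (∀ m : F[X], IsMinPolySeq s m ↔ m = Polynomial.C (M.coeff 0)⁻¹ * M) ∧
    IsLinearSpan s L ∧
    IsGeneratorPoly (seqCode n s) M ∧
    L ≤ n ∧ Module.finrank F (seqCode n s) = n - L

end

/-! Everything is read off from the zeros of `Λ` among the powers `η ^ j`. If `S` is the set of `j`
with `Λ(η ^ j) = 0`, then the generating series `Λ / (1 - x ^ n)` shows that the characteristic
polynomials of the sequence are the multiples, with constant term 1, of `M = ∏_{j ∉ S} (x - η ^ j)`.
The same `M` generates the code, so minimal polynomial, linear span and dimension all follow from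
`S` (`seqAndCodeGivenBy_of_roots`).

Since `(n - 1) / 4 = 0` in `K`, one has `Λ(1) = ρ`, and `Λ(η ^ j) = ρ - 1 - η_k` when `j` has
quartic index `k` (`eval_cycSeq`). So only two questions matter: which periods equal `-1` (for `ρ =
0`), and which vanish (for `ρ = 1`). As `n ≡ 1 mod 8`, `-1` is a fourth power, and products of
distinct periods expand in cyclotomic numbers (`quarticPeriod_mul`). With `η_0 + η_2 = 0` and `η_1 +
η_3 = -1` this collapses to `η_0 ^ 2 = (1,3)` and `η_1 η_3 = -(0,2)`. The norm of the quartic Jacobi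
sum, the uniqueness of `n` as a sum of two squares and the sign normalization of `u` identify
`(1,3)` with `E` and `(0,2)` with `C` (`cyclotomicNumber_zero_two`). The congruences on `E` and `C`
thus decide `η_0 ^ 2 ∈ {0, 1}` and `η_1 η_3 = 0`, which gives the six cases.

For the weights, a convolution argument gives the square root bound for odd-like words
(`card_le_sq_of_sum_ne_zero`), and a Gleason–Prange twist carries it over to even-like words when
the code vanishes at all nonsquares (`card_le_sq_of_nonsquare_zeros`). The bounds `B_1` and `B_2`
need no estimate of weights: where they are asserted, `√r = q ^ ((n-1)/8)` is at least `n (q - 1) +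
1`, which makes both nonpositive (`mul_card_lt_pow`). The small exceptions are `n = 17`, which falls
in no case with such a bound, and `n = 41, q = 2`, which the order condition excludes. -/

/-- The polynomial `s_0 + s_1 x + ⋯ + s_{n-1} x^{n-1}`. -/
noncomputable def seqPoly {F : Type*} [Field F] (n : ℕ) (s : ℕ → F) : F[X] :=
  ∑ i ∈ Finset.range n, Polynomial.monomial i (s i)

/-! ### Characteristic polynomials of a periodic sequence through its generating series. -/

section Sequences

variable {F : Type*} [Field F]

lemma seqPoly_coeff (n : ℕ) (s : ℕ → F) (i : ℕ) :
    (seqPoly n s).coeff i = if i < n then s i else 0 := by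
  simp [seqPoly, Polynomial.coeff_monomial]

lemma coeff_mul_mk {c : F[X]} {l i : ℕ} (s : ℕ → F) (hc : c.natDegree ≤ l) (hi : l ≤ i) :
    PowerSeries.coeff i ((c : PowerSeries F) * PowerSeries.mk s) =
      ∑ j ∈ Finset.range (l + 1), c.coeff j * s (i - j) := by
  rw [PowerSeries.coeff_mul]
  simp only [Polynomial.coeff_coe, PowerSeries.coeff_mk]
  rw [Finset.Nat.sum_antidiagonal_eq_sum_range_succ (fun a b => c.coeff a * s b)]
  symm
  apply Finset.sum_subset
  · intro j hj
    simp only [Finset.mem_range] at *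
    omega
  · intro j _ hj
    simp only [Finset.mem_range] at hj
    rw [Polynomial.coeff_eq_zero_of_natDegree_lt (by omega), zero_mul]

lemma one_sub_X_pow_mul_mk {n : ℕ} {s : ℕ → F} (hs : ∀ i, s (i + n) = s i) :
    (1 - PowerSeries.X ^ n) * PowerSeries.mk s = (seqPoly n s : PowerSeries F) := by
  ext i
  rw [sub_mul, one_mul, map_sub, PowerSeries.coeff_X_pow_mul', Polynomial.coeff_coe,
    seqPoly_coeff, PowerSeries.coeff_mk]
  by_cases h : n ≤ i
  · obtain ⟨k, rfl⟩ := Nat.exists_eq_add_of_le h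
    simp [add_comm n k, hs k]
  · rw [if_neg h, if_pos (by omega), sub_zero]

lemma one_sub_X_pow_coe (n : ℕ) :
    (((1 - X ^ n : F[X])) : PowerSeries F) = 1 - PowerSeries.X ^ n := by
  simp

/-- The recurrence kills every coefficient of `c · ∑ s_i x^i` from index `l` on, so this series is a
polynomial, and multiplying by `1 - x^n` gives the divisibility. -/
lemma GeneratesSeq.dvd {n l : ℕ} {s : ℕ → F} (hs : ∀ i, s (i + n) = s i) {c : F[X]}
    (h : GeneratesSeq s l c) : X ^ n - 1 ∣ c * seqPoly n s := by
  obtain ⟨-, hl, hrec⟩ := h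
  have hP : (c : PowerSeries F) * PowerSeries.mk s =
      ((PowerSeries.trunc l ((c : PowerSeries F) * PowerSeries.mk s) : F[X]) : PowerSeries F) := by
    ext i
    rw [Polynomial.coeff_coe, PowerSeries.coeff_trunc]
    split_ifs with hi
    · rfl
    · rw [coeff_mul_mk s hl (by omega)]
      exact hrec i (by omega)
  -- Only the sign of the divisor changes, to match the factor `1 - x^n` of the generating series.
  rw [← dvd_neg (a := X ^ n - 1), ← neg_dvd, dvd_neg]
  refine ⟨PowerSeries.trunc l ((c : PowerSeries F) * PowerSeries.mk s), ?_⟩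
  rw [neg_sub]
  apply Polynomial.coe_injective F
  rw [Polynomial.coe_mul, Polynomial.coe_mul, ← hP, one_sub_X_pow_coe, ← one_sub_X_pow_mul_mk hs]
  ring

lemma generatesSeq_of_dvd {n : ℕ} (hn : 0 < n) {s : ℕ → F} (hs : ∀ i, s (i + n) = s i) {c : F[X]}
    (hc : c.coeff 0 = 1) (h : X ^ n - 1 ∣ c * seqPoly n s) : GeneratesSeq s c.natDegree c := by
  refine ⟨hc, le_rfl, fun i hi => ?_⟩
  rw [← coeff_mul_mk s le_rfl hi]
  obtain ⟨P, hP⟩ := h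
  have hP' : c * seqPoly n s = (1 - X ^ n) * (-P) := by rw [hP]; ring
  have hne : (1 - PowerSeries.X ^ n : PowerSeries F) ≠ 0 := by
    intro h0
    have := congrArg (PowerSeries.coeff 0) h0
    rw [map_sub, PowerSeries.coeff_X_pow, if_neg (by omega)] at this
    simp at this
  have key : (c : PowerSeries F) * PowerSeries.mk s = ((-P : F[X]) : PowerSeries F) := by
    apply mul_left_cancel₀ hne
    rw [← one_sub_X_pow_coe n, ← Polynomial.coe_mul, ← hP', Polynomial.coe_mul,
      ← one_sub_X_pow_mul_mk hs, one_sub_X_pow_coe]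
    ring
  rw [key, Polynomial.coeff_coe, Polynomial.coeff_neg, neg_eq_zero]
  by_cases hP0 : P = 0
  · simp [hP0]
  apply Polynomial.coeff_eq_zero_of_natDegree_lt
  have hmon : (X ^ n - 1 : F[X]).Monic := Polynomial.monic_X_pow_sub_C (1 : F) hn.ne'
  have hdeg : (X ^ n - 1 : F[X]).natDegree = n := Polynomial.natDegree_X_pow_sub_C
  -- Because `seqPoly` has degree at most `n - 1`, this forces `deg P < deg c`, so the recurrence
  -- holds already from index `deg c`.
  have h1 : (c * seqPoly n s).natDegree = n + P.natDegree := by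
    rw [hP, hmon.natDegree_mul' hP0, hdeg]
  have h2 : (seqPoly n s).natDegree < n := by
    rw [← Nat.le_sub_one_iff_lt hn, Polynomial.natDegree_le_iff_coeff_eq_zero]
    intro m hm
    rw [seqPoly_coeff, if_neg (by omega)]
  have h3 := Polynomial.natDegree_mul_le (p := c) (q := seqPoly n s)
  omega

lemma isCharPolySeq_iff {n : ℕ} (hn : 0 < n) {s : ℕ → F} (hs : ∀ i, s (i + n) = s i) {c : F[X]} :
    IsCharPolySeq s c ↔ c.coeff 0 = 1 ∧ X ^ n - 1 ∣ c * seqPoly n s :=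
  ⟨fun ⟨_, h⟩ => ⟨h.1, h.dvd hs⟩, fun h => ⟨_, generatesSeq_of_dvd hn hs h.1 h.2⟩⟩

end Sequences

/-! ### Dimension of a cyclic code. -/

section Codes

variable {F : Type*} [Field F]

lemma wordPoly_apply (n : ℕ) (c : Fin n → F) :
    wordPoly F n c = ∑ i : Fin n, Polynomial.monomial (i : ℕ) (c i) := by
  simp [wordPoly]

lemma mem_cyclicCode {n : ℕ} {g : F[X]} {c : Fin n → F} :
    c ∈ cyclicCode n g ↔ g ∣ wordPoly F n c := by
  simp [cyclicCode, Ideal.mem_span_singleton]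

lemma wordPoly_coeff {n : ℕ} (c : Fin n → F) (i : Fin n) : (wordPoly F n c).coeff i = c i := by
  rw [wordPoly_apply, Polynomial.finsetSum_coeff, Finset.sum_eq_single i]
  · simp
  · intro j _ hj
    rw [Polynomial.coeff_monomial, if_neg (fun h => hj (Fin.ext h))]
  · simp

lemma wordPoly_mem_degreeLT {n : ℕ} (c : Fin n → F) : wordPoly F n c ∈ Polynomial.degreeLT F n := by
  rw [wordPoly_apply]
  refine Submodule.sum_mem _ fun i _ => ?_
  rw [Polynomial.mem_degreeLT]
  exact (Polynomial.degree_monomial_le _ _).trans_lt (by exact_mod_cast i.2)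

lemma wordPoly_coeffs {n : ℕ} {P : F[X]} (hP : P ∈ Polynomial.degreeLT F n) :
    wordPoly F n (fun i : Fin n => P.coeff i) = P := by
  ext i
  by_cases hi : i < n
  · exact wordPoly_coeff (fun i : Fin n => P.coeff i) ⟨i, hi⟩
  · have h1 := wordPoly_mem_degreeLT (fun i : Fin n => P.coeff i)
    rw [Polynomial.mem_degreeLT, Polynomial.degree_lt_iff_coeff_zero] at h1 hP
    rw [h1 i (by omega), hP i (by omega)]

/-- Multiplication by `g` as a map from the polynomials of degree less than `n - deg g` onto the
cyclic code generated by `g`. -/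
noncomputable def cyclicCodeEncode (n : ℕ) (g : F[X]) :
    Polynomial.degreeLT F (n - g.natDegree) →ₗ[F] (Fin n → F) where
  toFun P := fun i => (g * P.1).coeff i
  map_add' P Q := by ext i; simp [mul_add]
  map_smul' a P := by ext i; simp

lemma mul_mem_degreeLT {n : ℕ} {g P : F[X]} (hg : g.natDegree ≤ n)
    (hP : P ∈ Polynomial.degreeLT F (n - g.natDegree)) : g * P ∈ Polynomial.degreeLT F n := by
  rw [Polynomial.mem_degreeLT] at *
  by_cases hP0 : P = 0
  · simp [hP0]
  by_cases hg0 : g = 0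
  · simp [hg0]
  rw [Polynomial.degree_eq_natDegree hP0] at hP
  rw [Polynomial.degree_eq_natDegree (mul_ne_zero hg0 hP0), Polynomial.natDegree_mul hg0 hP0]
  have : P.natDegree < n - g.natDegree := by exact_mod_cast hP
  exact_mod_cast (by omega : g.natDegree + P.natDegree < n)

lemma finrank_cyclicCode {n : ℕ} {g : F[X]} (hg0 : g ≠ 0) (hg : g.natDegree ≤ n) :
    Module.finrank F (cyclicCode n g) = n - g.natDegree := by
  have hr : LinearMap.range (cyclicCodeEncode n g) = cyclicCode n g := by
    ext c
    rw [mem_cyclicCode, LinearMap.mem_range]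
    constructor
    · rintro ⟨P, rfl⟩
      have := wordPoly_coeffs (mul_mem_degreeLT hg P.2)
      exact ⟨P.1, this⟩
    · rintro ⟨P, hP⟩
      have hP' : P ∈ Polynomial.degreeLT F (n - g.natDegree) := by
        have h1 := wordPoly_mem_degreeLT c
        rw [hP, Polynomial.mem_degreeLT] at h1
        rw [Polynomial.mem_degreeLT]
        by_cases hP0 : P = 0
        · simp [hP0, bot_lt_iff_ne_bot]
        rw [Polynomial.degree_eq_natDegree (mul_ne_zero hg0 hP0),
          Polynomial.natDegree_mul hg0 hP0] at h1
        rw [Polynomial.degree_eq_natDegree hP0]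
        have : g.natDegree + P.natDegree < n := by exact_mod_cast h1
        exact_mod_cast (by omega : P.natDegree < n - g.natDegree)
      refine ⟨⟨P, hP'⟩, ?_⟩
      ext i
      change (g * P).coeff i = c i
      rw [← hP, wordPoly_coeff]
  have hi : Function.Injective (cyclicCodeEncode n g) := by
    rw [← LinearMap.ker_eq_bot, LinearMap.ker_eq_bot']
    intro P hP
    have h1 := wordPoly_coeffs (mul_mem_degreeLT hg P.2)
    have h2 : (fun i : Fin n => (g * P.1).coeff i) = 0 := hP
    rw [h2, map_zero] at h1
    exact Subtype.ext ((mul_eq_zero.mp h1.symm).resolve_left hg0)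
  rw [← hr, LinearMap.finrank_range_of_inj hi,
    (Polynomial.degreeLTEquiv F (n - g.natDegree)).finrank_eq, Module.finrank_fin_fun]

lemma cyclicCode_congr {n : ℕ} {g h : F[X]} (hgh : Associated g h) :
    cyclicCode n g = cyclicCode n h := by
  ext c
  rw [mem_cyclicCode, mem_cyclicCode, hgh.dvd_iff_dvd_left]

end Codes

/-! ### From the zeros of the sequence polynomial to its minimal polynomial and its code. -/

section Roots

variable {F K : Type*} [Field F] [Field K] [Algebra F K]

lemma prod_X_sub_C_pow_eq {n : ℕ} [NeZero n] {η : K} (hη : IsPrimitiveRoot η n) :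
    ∏ j : ZMod n, (X - C (η ^ j.val)) = X ^ n - 1 := by
  classical
  rw [X_pow_sub_one_eq_prod (NeZero.pos n) hη]
  refine Finset.prod_bij (fun j _ => η ^ j.val) ?_ ?_ ?_ ?_
  · intro j _
    rw [Polynomial.mem_nthRootsFinset (NeZero.pos n), ← pow_mul, mul_comm, pow_mul, hη.pow_eq_one,
      one_pow]
  · intro i _ j _ h
    exact ZMod.val_injective n (hη.pow_inj i.val_lt j.val_lt h)
  · intro b hb
    rw [Polynomial.mem_nthRootsFinset (NeZero.pos n)] at hb
    obtain ⟨i, hi, rfl⟩ := hη.eq_pow_of_pow_eq_one hb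
    exact ⟨(i : ZMod n), Finset.mem_univ _, by rw [ZMod.val_natCast, Nat.mod_eq_of_lt hi]⟩
  · intros; rfl

lemma pow_val_injective {n : ℕ} [NeZero n] {η : K} (hη : IsPrimitiveRoot η n) :
    Function.Injective fun j : ZMod n => η ^ j.val :=
  fun i j h => ZMod.val_injective n (hη.pow_inj i.val_lt j.val_lt h)

lemma prod_X_sub_C_pow_dvd_iff {n : ℕ} [NeZero n] {η : K} (hη : IsPrimitiveRoot η n)
    (S : Finset (ZMod n)) (P : K[X]) :
    ∏ j ∈ S, (X - C (η ^ j.val)) ∣ P ↔ ∀ j ∈ S, P.eval (η ^ j.val) = 0 := by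
  constructor
  · intro h j hj
    exact Polynomial.dvd_iff_isRoot.mp ((Finset.dvd_prod_of_mem
      (fun j : ZMod n => (X - C (η ^ j.val) : K[X])) hj).trans h)
  · intro h
    refine Finset.prod_dvd_of_coprime (fun i _ j _ hij => ?_)
      (fun j hj => Polynomial.dvd_iff_isRoot.mpr (h j hj))
    exact Polynomial.isCoprime_X_sub_C_of_isUnit_sub
      (sub_ne_zero.mpr fun h => hij (pow_val_injective hη h)).isUnit

/-- If the polynomial of the sequence `s` of period `n` vanishes exactly at the powers `η ^ j` with
`j ∈ S`, then the generator polynomial of its code has the remaining powers as its roots. -/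
lemma exists_generator {n : ℕ} [NeZero n] {η : K} (hη : IsPrimitiveRoot η n) {s : ℕ → F}
    (S : Finset (ZMod n))
    (hS : ∀ j, j ∈ S ↔ ((seqPoly n s).map (algebraMap F K)).eval (η ^ j.val) = 0) :
    ∃ M G : F[X], M.Monic ∧ M * G = X ^ n - 1 ∧
      M.map (algebraMap F K) = ∏ j ∈ Sᶜ, (X - C (η ^ j.val)) ∧
      G.map (algebraMap F K) = ∏ j ∈ S, (X - C (η ^ j.val)) ∧
      G ∣ seqPoly n s ∧ seqCode n s = cyclicCode n M := by
  classical
  have hn := NeZero.pos n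
  have hmon : (X ^ n - 1 : F[X]).Monic := Polynomial.monic_X_pow_sub_C (1 : F) hn.ne'
  set G₀ := EuclideanDomain.gcd (seqPoly n s) (X ^ n - 1) with hG₀
  have hG₀dvd : G₀ ∣ X ^ n - 1 := EuclideanDomain.gcd_dvd_right _ _
  have hG₀ne : G₀ ≠ 0 := fun h => hmon.ne_zero (zero_dvd_iff.mp (h ▸ hG₀dvd))
  have hG₀M : G₀ * ((X ^ n - 1) / G₀) = X ^ n - 1 := EuclideanDomain.mul_div_cancel' hG₀ne hG₀dvd
  set M₀ := (X ^ n - 1 : F[X]) / G₀ with hM₀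
  have hlc : G₀.leadingCoeff * M₀.leadingCoeff = 1 := by
    rw [← Polynomial.leadingCoeff_mul, hG₀M, hmon]
  have hlG : G₀.leadingCoeff ≠ 0 := left_ne_zero_of_mul_eq_one hlc
  have hlM : M₀.leadingCoeff ≠ 0 := right_ne_zero_of_mul_eq_one hlc
  -- The two leading coefficients are inverse to each other; exchanging them makes both factors
  -- monic without changing the product.
  set M := C G₀.leadingCoeff * M₀ with hM
  set G := C M₀.leadingCoeff * G₀ with hG
  have hMG : M * G = X ^ n - 1 := by
    rw [hM, hG, ← hG₀M]
    calc _ = C (G₀.leadingCoeff * M₀.leadingCoeff) * (G₀ * M₀) := by rw [C_mul]; ring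
      _ = _ := by rw [hlc, C_1, one_mul]
  have hMm : M.Monic := by
    rw [Polynomial.Monic, hM, Polynomial.leadingCoeff_mul, Polynomial.leadingCoeff_C, hlc]
  have hGm : G.Monic := by
    rw [Polynomial.Monic, hG, Polynomial.leadingCoeff_mul, Polynomial.leadingCoeff_C, mul_comm, hlc]
  have hGdvd : G ∣ seqPoly n s :=
    (Associated.dvd_iff_dvd_left (associated_unit_mul_left _ _
      (Polynomial.isUnit_C.mpr hlM.isUnit))).mpr (EuclideanDomain.gcd_dvd_left _ _)
  have hMdvd : ∀ c : F[X], G.map (algebraMap F K) ∣ c.map (algebraMap F K) ↔ G ∣ c :=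
    fun c => Polynomial.map_dvd_map' _
  have hXK : (X ^ n - 1 : F[X]).map (algebraMap F K) = X ^ n - 1 := by simp
  have hmK : (∏ j ∈ S, (X - C (η ^ j.val)) : K[X]).Monic :=
    Polynomial.monic_prod_of_monic _ _ fun j _ => Polynomial.monic_X_sub_C _
  have hsplit : (∏ j ∈ Sᶜ, (X - C (η ^ j.val)) : K[X]) * ∏ j ∈ S, (X - C (η ^ j.val)) =
      X ^ n - 1 := by rw [Finset.prod_compl_mul_prod, prod_X_sub_C_pow_eq hη]
  have h1 : ∏ j ∈ S, (X - C (η ^ j.val)) ∣ G.map (algebraMap F K) := by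
    have : ∏ j ∈ S, (X - C (η ^ j.val)) ∣ G₀.map (algebraMap F K) := by
      rw [hG₀, ← Polynomial.gcd_map]
      refine EuclideanDomain.dvd_gcd ?_ ?_
      · rw [prod_X_sub_C_pow_dvd_iff hη]
        exact fun j hj => (hS j).mp hj
      · rw [hXK, ← hsplit]
        exact dvd_mul_left _ _
    rw [hG, Polynomial.map_mul]
    exact this.mul_left _
  -- A power `η ^ j` with `j ∉ S` is a root of `M G` but not of `G`, which divides the sequence
  -- polynomial.
  have h2 : ∏ j ∈ Sᶜ, (X - C (η ^ j.val)) ∣ M.map (algebraMap F K) := by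
    rw [prod_X_sub_C_pow_dvd_iff hη]
    intro j hj
    have hz : (M.map (algebraMap F K) * G.map (algebraMap F K)).eval (η ^ j.val) = 0 := by
      rw [← Polynomial.map_mul, hMG, hXK]
      simp [pow_right_comm η j.val n, hη.pow_eq_one]
    rw [Polynomial.eval_mul] at hz
    refine (mul_eq_zero.mp hz).resolve_right fun hGz => (Finset.mem_compl.mp hj) ?_
    rw [hS]
    exact Polynomial.dvd_iff_isRoot.mp
      ((Polynomial.dvd_iff_isRoot.mpr hGz).trans ((hMdvd _).mpr hGdvd))
  have hprod : M.map (algebraMap F K) * G.map (algebraMap F K) =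
      (∏ j ∈ Sᶜ, (X - C (η ^ j.val)) : K[X]) * ∏ j ∈ S, (X - C (η ^ j.val)) := by
    rw [← Polynomial.map_mul, hMG, hXK, hsplit]
  -- Both factors are bounded below by their expected roots and the products agree, so equality
  -- holds.
  have hGeq : G.map (algebraMap F K) = ∏ j ∈ S, (X - C (η ^ j.val)) := by
    refine Polynomial.eq_of_monic_of_associated (hGm.map _) hmK (associated_of_dvd_dvd ?_ h1)
    obtain ⟨A, hA⟩ := h2
    refine ⟨A, ?_⟩
    have hne : (∏ j ∈ Sᶜ, (X - C (η ^ j.val)) : K[X]) ≠ 0 :=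
      (Polynomial.monic_prod_of_monic _ _ fun j _ => Polynomial.monic_X_sub_C _).ne_zero
    apply mul_left_cancel₀ hne
    rw [← hprod, hA]; ring
  refine ⟨M, G, hMm, hMG, ?_, hGeq, hGdvd, ?_⟩
  · rw [hGeq] at hprod
    exact mul_right_cancel₀ hmK.ne_zero hprod
  · have : seqCode n s = cyclicCode n M₀ := by
      unfold seqCode
      rw [hM₀, hG₀, seqPoly]
    rw [this]
    exact cyclicCode_congr (associated_unit_mul_left _ _
      (Polynomial.isUnit_C.mpr hlG.isUnit)).symm

lemma mem_seqCode_iff {n : ℕ} [NeZero n] {η : K} (hη : IsPrimitiveRoot η n) {s : ℕ → F}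
    (S : Finset (ZMod n))
    (hS : ∀ j, j ∈ S ↔ ((seqPoly n s).map (algebraMap F K)).eval (η ^ j.val) = 0) {c : Fin n → F} :
    c ∈ seqCode n s ↔
      ∀ j ∉ S, ((wordPoly F n c).map (algebraMap F K)).eval (η ^ j.val) = 0 := by
  obtain ⟨M, G, -, -, hM, -, -, hC⟩ := exists_generator hη S hS
  rw [hC, mem_cyclicCode, ← Polynomial.map_dvd_map' (algebraMap F K), hM,
    prod_X_sub_C_pow_dvd_iff hη]
  simp

lemma hasDefiningSet_seqCode {n : ℕ} [NeZero n] {η : K} (hη : IsPrimitiveRoot η n) {s : ℕ → F}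
    (S : Finset (ZMod n))
    (hS : ∀ j, j ∈ S ↔ ((seqPoly n s).map (algebraMap F K)).eval (η ^ j.val) = 0) :
    HasDefiningSet η (seqCode n s) Sᶜ := by
  obtain ⟨M, G, hMm, hMG, hM, -, -, hC⟩ := exists_generator hη S hS
  exact ⟨M, ⟨hMm, hMG ▸ dvd_mul_right _ _, hC⟩, hM⟩

theorem seqAndCodeGivenBy_of_roots {n : ℕ} [NeZero n] {η : K} (hη : IsPrimitiveRoot η n)
    {s : ℕ → F} (hs : ∀ i, s (i + n) = s i) (S : Finset (ZMod n))
    (hS : ∀ j, j ∈ S ↔ ((seqPoly n s).map (algebraMap F K)).eval (η ^ j.val) = 0) :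
    SeqAndCodeGivenBy n s (∏ j ∈ S, (X - C (η ^ j.val))) (n - S.card) := by
  classical
  have hn := NeZero.pos n
  obtain ⟨M, G, hMm, hMG, hM, hGm, hGs, hC⟩ := exists_generator hη S hS
  have hmon : (X ^ n - 1 : F[X]).Monic := Polynomial.monic_X_pow_sub_C (1 : F) hn.ne'
  have hG0 : G ≠ 0 := right_ne_zero_of_mul (hMG ▸ hmon.ne_zero)
  have hdegM : M.natDegree = n - S.card := by
    have h1 := congrArg Polynomial.natDegree hM
    rw [Polynomial.natDegree_map, Polynomial.natDegree_prod_of_monic _ _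
      (fun j _ => Polynomial.monic_X_sub_C _)] at h1
    simp_rw [h1, Polynomial.natDegree_X_sub_C]
    simp [Finset.card_compl, ZMod.card]
  -- Tested root by root: where the sequence polynomial does not vanish, `c` has to.
  have hcop : ∀ c : F[X], X ^ n - 1 ∣ c * seqPoly n s ↔ M ∣ c := by
    intro c
    constructor
    · intro h
      rw [← Polynomial.map_dvd_map' (algebraMap F K), hM, prod_X_sub_C_pow_dvd_iff hη]
      intro j hj
      rw [← Polynomial.map_dvd_map' (algebraMap F K)] at h
      have hXK : (X ^ n - 1 : F[X]).map (algebraMap F K) = X ^ n - 1 := by simp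
      rw [hXK, ← prod_X_sub_C_pow_eq hη, prod_X_sub_C_pow_dvd_iff hη, Polynomial.map_mul] at h
      have h2 := h j (Finset.mem_univ j)
      rw [Polynomial.eval_mul] at h2
      exact (mul_eq_zero.mp h2).resolve_right fun h3 => (Finset.mem_compl.mp hj) ((hS j).mpr h3)
    · intro h
      rw [← hMG]
      exact mul_dvd_mul h hGs
  have hchar : ∀ c : F[X], IsCharPolySeq s c ↔ c.coeff 0 = 1 ∧ M ∣ c := fun c => by
    rw [isCharPolySeq_iff hn hs, hcop]
  have hM0 : M.coeff 0 ≠ 0 := by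
    intro h0
    have := congrArg (fun P : F[X] => P.coeff 0) hMG
    simp only [Polynomial.mul_coeff_zero, h0, zero_mul, Polynomial.coeff_sub,
      Polynomial.coeff_X_pow, Polynomial.coeff_one_zero] at this
    rw [if_neg (by omega)] at this
    simp at this
  set m₀ := C (M.coeff 0)⁻¹ * M with hm₀
  have hm₀char : m₀.coeff 0 = 1 ∧ M ∣ m₀ :=
    ⟨by rw [hm₀, Polynomial.coeff_C_mul, inv_mul_cancel₀ hM0], dvd_mul_left _ _⟩
  have hm₀deg : m₀.natDegree = M.natDegree :=
    Polynomial.natDegree_C_mul (inv_ne_zero hM0)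
  have hne : ∀ c : F[X], c.coeff 0 = 1 → c ≠ 0 := fun c h h0 => by simp [h0] at h
  have hle : ∀ c : F[X], c.coeff 0 = 1 → M ∣ c → M.natDegree ≤ c.natDegree := fun c h hd =>
    Polynomial.natDegree_le_of_dvd hd (hne c h)
  refine ⟨M, ?_, ?_, ?_, ⟨hMm, hMG ▸ dvd_mul_right _ _, hC⟩, Nat.sub_le _ _, ?_⟩
  · rw [← hGm, ← Polynomial.map_mul, hMG]; simp
  · intro m
    constructor
    · rintro ⟨hm, hmin⟩
      obtain ⟨hm1, k, hk⟩ := (hchar m).mp hm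
      have hdeg := hmin m₀ ((hchar m₀).mpr hm₀char)
      -- Minimality makes the cofactor `k` a constant, and the constant term 1 then determines it.
      have hk0 : k ≠ 0 := fun h => hne m hm1 (by rw [hk, h, mul_zero])
      rw [hm₀deg, hk, hMm.natDegree_mul' hk0] at hdeg
      have hkc := Polynomial.eq_C_of_natDegree_eq_zero (by omega : k.natDegree = 0)
      have hk1 : M.coeff 0 * k.coeff 0 = 1 := by rw [← hm1, hk, Polynomial.mul_coeff_zero]
      rw [hk, hkc, ← eq_inv_of_mul_eq_one_right hk1, mul_comm]
    · rintro rfl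
      refine ⟨(hchar _).mpr hm₀char, fun c hc => ?_⟩
      rw [hm₀deg]
      exact hle c ((hchar c).mp hc).1 ((hchar c).mp hc).2
  · rw [← hdegM]
    constructor
    · refine ⟨m₀, ?_⟩
      have := generatesSeq_of_dvd hn hs hm₀char.1 ((hcop m₀).mpr hm₀char.2)
      rwa [hm₀deg] at this
    · rintro l ⟨c, hc⟩
      exact (hle c hc.1 ((hchar c).mp ⟨l, hc⟩).2).trans hc.2.1
  · rw [hC, finrank_cyclicCode hMm.ne_zero (by omega), hdegM]

end Roots

/-! ### Quartic classes modulo `n`. -/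

section QuarticIndex

variable {n : ℕ} [Fact n.Prime]

open Classical in
/-- The discrete logarithm to the base `g`, reduced modulo `4` (and `0` at `0`). -/
noncomputable def quarticIndex (g : (ZMod n)ˣ) (x : ZMod n) : ZMod 4 :=
  if h : ∃ m : ℕ, x = (g : ZMod n) ^ m then ((h.choose : ℕ) : ZMod 4) else 0

open Classical in
/-- The nonzero residues with quartic index `k`. -/
noncomputable def quarticClass (g : (ZMod n)ˣ) (k : ZMod 4) : Finset (ZMod n) :=
  Finset.univ.filter fun x => x ≠ 0 ∧ quarticIndex g x = k

lemma mem_quarticClass {g : (ZMod n)ˣ} {k : ZMod 4} {x : ZMod n} :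
    x ∈ quarticClass g k ↔ x ≠ 0 ∧ quarticIndex g x = k := by
  simp [quarticClass]

variable {g : (ZMod n)ˣ}

lemma orderOf_generator (hg : Subgroup.zpowers g = ⊤) : orderOf g = n - 1 := by
  rw [orderOf_eq_card_of_zpowers_eq_top hg, Nat.card_eq_fintype_card, ZMod.card_units]

lemma exists_eq_pow (hg : Subgroup.zpowers g = ⊤) {x : ZMod n} (hx : x ≠ 0) :
    ∃ m : ℕ, x = (g : ZMod n) ^ m := by
  have h : Units.mk0 x hx ∈ Subgroup.zpowers g := hg ▸ Subgroup.mem_top _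
  rw [← mem_powers_iff_mem_zpowers] at h
  obtain ⟨m, hm⟩ := h
  exact ⟨m, by simpa using (congrArg Units.val hm).symm⟩

/-- The logarithm is unique modulo `n - 1`, a multiple of 4, so the exponent picked by `choose` is
irrelevant. -/
lemma quarticIndex_pow (hn : n % 8 = 1) (hg : Subgroup.zpowers g = ⊤) (m : ℕ) :
    quarticIndex g ((g : ZMod n) ^ m) = m := by
  have h : ∃ k : ℕ, (g : ZMod n) ^ m = (g : ZMod n) ^ k := ⟨m, rfl⟩
  rw [quarticIndex, dif_pos h]
  have h1 : g ^ m = g ^ h.choose := by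
    ext
    simpa using h.choose_spec
  rw [pow_eq_pow_iff_modEq, orderOf_generator hg] at h1
  rw [ZMod.natCast_eq_natCast_iff]
  exact (h1.of_dvd (by omega)).symm

lemma quarticIndex_mul (hn : n % 8 = 1) (hg : Subgroup.zpowers g = ⊤) {x y : ZMod n} (hx : x ≠ 0)
    (hy : y ≠ 0) : quarticIndex g (x * y) = quarticIndex g x + quarticIndex g y := by
  obtain ⟨a, rfl⟩ := exists_eq_pow hg hx
  obtain ⟨b, rfl⟩ := exists_eq_pow hg hy
  rw [← pow_add, quarticIndex_pow hn hg, quarticIndex_pow hn hg, quarticIndex_pow hn hg,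
    Nat.cast_add]

lemma quarticIndex_one (hn : n % 8 = 1) (hg : Subgroup.zpowers g = ⊤) :
    quarticIndex g (1 : ZMod n) = 0 := by
  simpa using quarticIndex_pow hn hg 0

lemma quarticIndex_generator (hn : n % 8 = 1) (hg : Subgroup.zpowers g = ⊤) :
    quarticIndex g (g : ZMod n) = 1 := by
  simpa using quarticIndex_pow hn hg 1

lemma quarticIndex_inv (hn : n % 8 = 1) (hg : Subgroup.zpowers g = ⊤) {x : ZMod n} (hx : x ≠ 0) :
    quarticIndex g x⁻¹ = - quarticIndex g x := by
  have h := quarticIndex_mul hn hg hx (inv_ne_zero hx)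
  rw [mul_inv_cancel₀ hx, quarticIndex_one hn hg] at h
  exact (neg_eq_of_add_eq_zero_right h.symm).symm

/-- If `-1 = g ^ m` then `n - 1` divides `2m`; as 8 divides `n - 1`, 4 divides `m`. This is where
modulus 8, rather than 4, is essential. -/
lemma quarticIndex_neg_one (hn : n % 8 = 1) (hg : Subgroup.zpowers g = ⊤) :
    quarticIndex g (-1 : ZMod n) = 0 := by
  obtain ⟨m, hm⟩ := exists_eq_pow hg (neg_ne_zero.mpr (one_ne_zero (α := ZMod n)))
  rw [hm, quarticIndex_pow hn hg]
  have h1 : g ^ (2 * m) = 1 := by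
    ext
    rw [mul_comm, pow_mul, Units.val_pow_eq_pow_val, Units.val_pow_eq_pow_val, ← hm]
    simp
  have h2 := orderOf_dvd_of_pow_eq_one h1
  rw [orderOf_generator hg] at h2
  rw [ZMod.natCast_eq_zero_iff]
  obtain ⟨c, hc⟩ := h2
  have h8 : 8 ∣ n - 1 := by omega
  obtain ⟨d, hd⟩ := h8
  rw [hd, mul_assoc] at hc
  exact ⟨d * c, by omega⟩

lemma quarticIndex_neg (hn : n % 8 = 1) (hg : Subgroup.zpowers g = ⊤) (x : ZMod n) :
    quarticIndex g (-x) = quarticIndex g x := by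
  by_cases hx : x = 0
  · simp [hx]
  rw [← neg_one_mul, quarticIndex_mul hn hg (neg_ne_zero.mpr one_ne_zero) hx,
    quarticIndex_neg_one hn hg, zero_add]

lemma cyclotomicClass_eq (hn : n % 8 = 1) (hg : Subgroup.zpowers g = ⊤) (k : ℕ) :
    cyclotomicClass 4 g k = quarticClass g k := by
  ext x
  rw [mem_quarticClass, cyclotomicClass, Finset.mem_filter]
  constructor
  · rintro ⟨-, y, hy, rfl⟩
    refine ⟨Units.ne_zero _, ?_⟩
    rw [← mem_powers_iff_mem_zpowers] at hy
    obtain ⟨m, rfl⟩ := hy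
    simp only [← pow_mul, ← pow_add, Units.val_pow_eq_pow_val]
    rw [quarticIndex_pow hn hg, Nat.cast_add, Nat.cast_mul]
    have : ((4 : ℕ) : ZMod 4) = 0 := rfl
    rw [this, zero_mul, add_zero]
  · rintro ⟨hx, hk⟩
    refine ⟨Finset.mem_univ _, ?_⟩
    obtain ⟨m, rfl⟩ := exists_eq_pow hg hx
    rw [quarticIndex_pow hn hg, ZMod.natCast_eq_natCast_iff] at hk
    obtain ⟨c, hc⟩ := hk.dvd
    refine ⟨(g ^ 4) ^ (-c), Subgroup.zpow_mem_zpowers _ _, ?_⟩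
    have h1 : g ^ m = g ^ k * (g ^ 4) ^ (-c) := by
      rw [← zpow_natCast g m, ← zpow_natCast g k, ← zpow_natCast g 4, ← zpow_mul, ← zpow_add]
      congr 1
      push_cast at hc ⊢
      omega
    rw [← h1, Units.val_pow_eq_pow_val]

lemma sum_zmod_four {M : Type*} [AddCommMonoid M] (f : ZMod 4 → M) :
    ∑ k, f k = f 0 + f 1 + f 2 + f 3 :=
  Fin.sum_univ_four f

lemma sum_quarticClass {M : Type*} [AddCommMonoid M] (f : ZMod n → M) :
    ∑ k : ZMod 4, ∑ x ∈ quarticClass g k, f x = ∑ x ∈ Finset.univ.erase 0, f x := by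
  classical
  rw [← Finset.sum_fiberwise (Finset.univ.erase 0) (quarticIndex g) f]
  refine Finset.sum_congr rfl fun k _ => Finset.sum_congr ?_ fun _ _ => rfl
  ext x
  simp [mem_quarticClass]

lemma sum_quarticClass_mul (hn : n % 8 = 1) (hg : Subgroup.zpowers g = ⊤) {M : Type*}
    [AddCommMonoid M] (f : ZMod n → M) {a : ZMod n} (ha : a ≠ 0) (k : ZMod 4) :
    ∑ x ∈ quarticClass g k, f (a * x) = ∑ x ∈ quarticClass g (quarticIndex g a + k), f x := by
  refine Finset.sum_nbij' (fun x => a * x) (fun x => a⁻¹ * x) ?_ ?_ ?_ ?_ ?_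
  · intro x hx
    rw [mem_quarticClass] at *
    exact ⟨mul_ne_zero ha hx.1, by rw [quarticIndex_mul hn hg ha hx.1, hx.2]⟩
  · intro x hx
    rw [mem_quarticClass] at *
    refine ⟨mul_ne_zero (inv_ne_zero ha) hx.1, ?_⟩
    rw [quarticIndex_mul hn hg (inv_ne_zero ha) hx.1, hx.2, quarticIndex_inv hn hg ha]
    ring
  · intro x _
    exact inv_mul_cancel_left₀ ha x
  · intro x _
    exact mul_inv_cancel_left₀ ha x
  · intros; rfl

/-- Multiplication by `g` permutes the four classes cyclically, so they share the `n - 1` nonzero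
residues equally. -/
lemma card_quarticClass (hn : n % 8 = 1) (hg : Subgroup.zpowers g = ⊤) (k : ZMod 4) :
    (quarticClass g k).card = (n - 1) / 4 := by
  have h1 : ∀ k, (quarticClass g k).card = (quarticClass g (1 + k)).card := by
    intro k
    have := sum_quarticClass_mul hn hg (fun _ => 1) (Units.ne_zero g) k
    rw [quarticIndex_generator hn hg] at this
    simpa using this
  have h2 := sum_quarticClass (g := g) (fun _ => 1)
  rw [sum_zmod_four] at h2
  simp only [Finset.sum_const, smul_eq_mul, mul_one, Finset.card_erase_of_mem (Finset.mem_univ _),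
    Finset.card_univ, ZMod.card] at h2
  have e0 := h1 0
  have e1 := h1 1
  have e2 := h1 2
  have e3 : ∀ k : ZMod 4, k = 0 ∨ k = 1 ∨ k = 2 ∨ k = 3 := by decide
  rw [show (1 + 0 : ZMod 4) = 1 from rfl] at e0
  rw [show (1 + 1 : ZMod 4) = 2 from rfl] at e1
  rw [show (1 + 2 : ZMod 4) = 3 from rfl] at e2
  rcases e3 k with rfl | rfl | rfl | rfl <;> omega

/-! ### Cyclotomic numbers of order four and their symmetries. -/

open Classical in
/-- The residues `x ≠ 0, 1` for which `x` has quartic index `k` and `1 - x` has quartic index `l`. -/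
noncomputable def quarticPairs (g : (ZMod n)ˣ) (k l : ZMod 4) : Finset (ZMod n) :=
  Finset.univ.filter fun x => (x ≠ 0 ∧ 1 - x ≠ 0) ∧ quarticIndex g x = k ∧ quarticIndex g
    (1 - x) = l

lemma mem_quarticPairs {k l : ZMod 4} {x : ZMod n} : x ∈ quarticPairs g k l ↔
    (x ≠ 0 ∧ 1 - x ≠ 0) ∧ quarticIndex g x = k ∧ quarticIndex g (1 - x) = l := by
  simp [quarticPairs]

/-- The cyclotomic numbers of order four. -/
noncomputable def cyclotomicNumber (g : (ZMod n)ˣ) (k l : ZMod 4) : ℕ := (quarticPairs g k l).card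

lemma cyclotomicNumber_comm (k l : ZMod 4) : cyclotomicNumber g k l = cyclotomicNumber g l k := by
  refine Finset.card_nbij' (fun x => 1 - x) (fun x => 1 - x) ?_ ?_ ?_ ?_
  · intro x hx
    simp only [Finset.mem_coe, mem_quarticPairs, sub_sub_cancel] at *
    tauto
  · intro x hx
    simp only [Finset.mem_coe, mem_quarticPairs, sub_sub_cancel] at *
    tauto
  · intro x _; simp
  · intro x _; simp

/-- Write `1 - x⁻¹ = -(1 - x) x⁻¹`; the sign does not affect the index. -/
lemma inv_mem_quarticPairs (hn : n % 8 = 1) (hg : Subgroup.zpowers g = ⊤) {k l : ZMod 4}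
    {x : ZMod n} (hx : x ∈ quarticPairs g k l) : x⁻¹ ∈ quarticPairs g (-k) (l - k) := by
  rw [mem_quarticPairs] at *
  obtain ⟨⟨h0, h1⟩, hk, hl⟩ := hx
  have h2 : 1 - x⁻¹ = -((1 - x) * x⁻¹) := by field_simp; ring
  refine ⟨⟨inv_ne_zero h0, ?_⟩, ?_, ?_⟩
  · rw [h2]
    exact neg_ne_zero.mpr (mul_ne_zero h1 (inv_ne_zero h0))
  · rw [quarticIndex_inv hn hg h0, hk]
  · rw [h2, quarticIndex_neg hn hg, quarticIndex_mul hn hg h1 (inv_ne_zero h0),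
      quarticIndex_inv hn hg h0, hk, hl, sub_eq_add_neg]

lemma cyclotomicNumber_inv (hn : n % 8 = 1) (hg : Subgroup.zpowers g = ⊤) (k l : ZMod 4) :
    cyclotomicNumber g k l = cyclotomicNumber g (-k) (l - k) := by
  refine Finset.card_nbij' (fun x => x⁻¹) (fun x => x⁻¹) ?_ ?_ ?_ ?_
  · exact fun x hx => inv_mem_quarticPairs hn hg hx
  · intro x hx
    have := inv_mem_quarticPairs hn hg hx
    rwa [neg_neg, show l - k - -k = l by ring] at this
  · intro x _; simp
  · intro x _; simp

/-- Each row runs over a whole class, except that `x = 1`, of index 0, is missing because `1 - x =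
0`. -/
lemma sum_cyclotomicNumber (hn : n % 8 = 1) (hg : Subgroup.zpowers g = ⊤) (k : ZMod 4) :
    (∑ l, cyclotomicNumber g k l) + (if k = 0 then 1 else 0) = (n - 1) / 4 := by
  classical
  have h1 : ∑ l, cyclotomicNumber g k l = ((quarticClass g k).erase 1).card := by
    rw [Finset.card_eq_sum_card_fiberwise (f := fun x => quarticIndex g (1 - x)) (t := Finset.univ)
      (fun _ _ => Finset.mem_coe.mpr (Finset.mem_univ _))]
    refine Finset.sum_congr rfl fun l _ => ?_
    rw [cyclotomicNumber]
    congr 1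
    ext x
    simp only [mem_quarticPairs, Finset.mem_filter, Finset.mem_erase, mem_quarticClass, ne_eq,
      sub_eq_zero]
    have : (1 = x) ↔ (x = 1) := eq_comm
    tauto
  rw [h1, ← card_quarticClass hn hg k]
  split_ifs with hk
  · apply Finset.card_erase_add_one
    rw [mem_quarticClass, quarticIndex_one hn hg]
    exact ⟨one_ne_zero, hk.symm⟩
  · rw [Finset.erase_eq_of_notMem, add_zero]
    rw [mem_quarticClass, quarticIndex_one hn hg]
    exact fun h => hk h.2.symm

/-! ### The quartic character, its Jacobi sum, and the values of two cyclotomic numbers. -/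

/-- The real part of `i ^ k`. -/
def rePowI (k : ZMod 4) : ℤ := if k = 0 then 1 else if k = 2 then -1 else 0

/-- The imaginary part of `i ^ k`. -/
def imPowI (k : ZMod 4) : ℤ := if k = 1 then 1 else if k = 3 then -1 else 0

/-- `i ^ k` for a residue `k` modulo `4`. -/
noncomputable def powI (k : ZMod 4) : ℂ := rePowI k + imPowI k * Complex.I

lemma powI_add (k l : ZMod 4) : powI (k + l) = powI k * powI l := by
  have h1 : ∀ k l, rePowI (k + l) = rePowI k * rePowI l - imPowI k * imPowI l := by decide
  have h2 : ∀ k l, imPowI (k + l) = rePowI k * imPowI l + imPowI k * rePowI l := by decide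
  have hI := Complex.I_mul_I
  simp only [powI, h1, h2]
  push_cast
  linear_combination (-(imPowI k * imPowI l : ℂ)) * hI

/-- The quartic residue character attached to the generator `g`. -/
noncomputable def quarticChar (hn : n % 8 = 1) (hg : Subgroup.zpowers g = ⊤) :
    MulChar (ZMod n) ℂ where
  toFun x := if x = 0 then 0 else powI (quarticIndex g x)
  map_one' := by
    rw [if_neg one_ne_zero, quarticIndex_one hn hg, powI, show rePowI 0 = 1 by decide,
      show imPowI 0 = 0 by decide]
    simp
  map_mul' x y := by
    by_cases hx : x = 0
    · simp [hx]
    by_cases hy : y = 0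
    · simp [hy]
    rw [if_neg hx, if_neg hy, if_neg (mul_ne_zero hx hy), quarticIndex_mul hn hg hx hy, powI_add]
  map_nonunit' x hx := by
    rw [isUnit_iff_ne_zero, not_not] at hx
    exact if_pos hx

lemma quarticChar_apply (hn : n % 8 = 1) (hg : Subgroup.zpowers g = ⊤) (x : ZMod n) :
    quarticChar hn hg x = if x = 0 then 0 else powI (quarticIndex g x) := rfl

lemma quarticChar_inv_apply (hn : n % 8 = 1) (hg : Subgroup.zpowers g = ⊤) (x : ZMod n) :
    (quarticChar hn hg)⁻¹ x = if x = 0 then 0 else powI (-quarticIndex g x) := by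
  rw [MulChar.inv_apply', quarticChar_apply]
  by_cases hx : x = 0
  · simp [hx]
  · rw [if_neg (inv_ne_zero hx), if_neg hx, quarticIndex_inv hn hg hx]

open Classical in
lemma sum_quarticChar_form (F : ZMod 4 → ZMod 4 → ℤ) :
    (∑ x : ZMod n, if x ≠ 0 ∧ 1 - x ≠ 0 then F (quarticIndex g x) (quarticIndex g (1 - x)) else 0) =
      ∑ k, ∑ l, (cyclotomicNumber g k l : ℤ) * F k l := by
  rw [← Finset.sum_filter, ← Fintype.sum_prod_type' (f := fun k l =>
    (cyclotomicNumber g k l : ℤ) * F k l),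
    ← Finset.sum_fiberwise' _ (fun x => (quarticIndex g x, quarticIndex g (1 - x)))
    (fun p => F p.1 p.2)]
  refine Finset.sum_congr rfl fun p _ => ?_
  rw [Finset.sum_const, nsmul_eq_mul]
  congr 2
  rw [cyclotomicNumber]
  congr 1
  ext x
  simp [mem_quarticPairs, Prod.ext_iff]

/-- The two sums are the real and imaginary parts of `J(χ, χ)` for the quartic character `χ`, and
`J(χ, χ) J(χ⁻¹, χ⁻¹) = n` because `χ` and `χ ^ 2` are nontrivial. -/
lemma jacobi_sq_add_sq (hn : n % 8 = 1) (hg : Subgroup.zpowers g = ⊤) :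
    (∑ k, ∑ l, (cyclotomicNumber g k l : ℤ) * rePowI (k + l)) ^ 2 +
      (∑ k, ∑ l, (cyclotomicNumber g k l : ℤ) * imPowI (k + l)) ^ 2 = n := by
  classical
  set χ := quarticChar hn hg with hχ
  rw [← sum_quarticChar_form (fun k l => rePowI (k + l)),
    ← sum_quarticChar_form (fun k l => imPowI (k + l))]
  set s : ℤ := ∑ x : ZMod n, if x ≠ 0 ∧ 1 - x ≠ 0 then
    rePowI (quarticIndex g x + quarticIndex g (1 - x)) else 0 with hs
  set t : ℤ := ∑ x : ZMod n, if x ≠ 0 ∧ 1 - x ≠ 0 then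
    imPowI (quarticIndex g x + quarticIndex g (1 - x)) else 0 with ht
  have hre : ∀ k, rePowI (-k) = rePowI k := by decide
  have him : ∀ k, imPowI (-k) = -imPowI k := by decide
  have hJ : jacobiSum χ χ = s + t * Complex.I := by
    rw [jacobiSum, hs, ht]
    push_cast
    rw [Finset.sum_mul, ← Finset.sum_add_distrib]
    refine Finset.sum_congr rfl fun x _ => ?_
    rw [hχ, quarticChar_apply, quarticChar_apply]
    by_cases hx : x = 0
    · simp [hx]
    by_cases hx1 : 1 - x = 0
    · simp [hx1]
    rw [if_neg hx, if_neg hx1, if_pos ⟨hx, hx1⟩, if_pos ⟨hx, hx1⟩, ← powI_add, powI]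
  have hJ' : jacobiSum χ⁻¹ χ⁻¹ = s - t * Complex.I := by
    rw [jacobiSum, hs, ht]
    push_cast
    rw [Finset.sum_mul, ← Finset.sum_sub_distrib]
    refine Finset.sum_congr rfl fun x _ => ?_
    rw [hχ, quarticChar_inv_apply, quarticChar_inv_apply]
    by_cases hx : x = 0
    · simp [hx]
    by_cases hx1 : 1 - x = 0
    · simp [hx1]
    rw [if_neg hx, if_neg hx1, if_pos ⟨hx, hx1⟩, if_pos ⟨hx, hx1⟩, ← powI_add, powI, ← neg_add,
      hre, him]
    push_cast
    ring
  have hg1 : χ (g : ZMod n) = Complex.I := by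
    rw [hχ, quarticChar_apply, if_neg (Units.ne_zero g), quarticIndex_generator hn hg, powI]
    have h1 : rePowI 1 = 0 := by decide
    have h2 : imPowI 1 = 1 := by decide
    simp [h1, h2]
  have hχ1 : χ ≠ 1 := by
    intro h
    rw [h, MulChar.one_apply_coe] at hg1
    simpa using congrArg Complex.re hg1
  have hχ2 : χ * χ ≠ 1 := by
    intro h
    have h2 : (χ * χ) (g : ZMod n) = -1 := by rw [MulChar.mul_apply, hg1, Complex.I_mul_I]
    rw [h, MulChar.one_apply_coe] at h2
    norm_num at h2
  have hchar : ringChar ℂ ≠ ringChar (ZMod n) := by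
    rw [ringChar.eq_zero, ZMod.ringChar_zmod_n]
    exact (NeZero.ne n).symm
  have key := jacobiSum_mul_jacobiSum_inv hchar hχ1 hχ1 hχ2
  rw [hJ, hJ', ZMod.card] at key
  have hI := Complex.I_mul_I
  have : ((s ^ 2 + t ^ 2 : ℤ) : ℂ) = ((n : ℤ) : ℂ) := by
    push_cast
    rw [← key]
    linear_combination (t : ℂ) ^ 2 * hI
  exact_mod_cast this

/-- The classical uniqueness argument: `p` divides `(ad - cb)(ad + cb)`, and changing the sign of
`d` reduces to `p ∣ ad - cb`. -/
lemma sq_eq_of_sq_add_sq {p : ℕ} (hp : p.Prime) {a b c d : ℤ} (h1 : a ^ 2 + b ^ 2 = p)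
    (h2 : c ^ 2 + d ^ 2 = p) (ha : Odd a) (hc : Odd c) (hb : Even b) : a ^ 2 = c ^ 2 := by
  have hp0 : (p : ℤ) ≠ 0 := by exact_mod_cast hp.ne_zero
  have main : ∀ d : ℤ, c ^ 2 + d ^ 2 = p → (p : ℤ) ∣ a * d - c * b → a ^ 2 = c ^ 2 := by
    intro d h2 hd
    obtain ⟨k, hk⟩ := hd
    -- Brahmagupta's identity. The second square is odd, hence positive, so the multiple `ad - cb`
    -- of `p` must be 0.
    have h3 : (a * d - c * b) ^ 2 + (a * c + b * d) ^ 2 = (p : ℤ) ^ 2 := by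
      rw [sq (p : ℤ)]
      nth_rewrite 1 [← h1]
      rw [← h2]
      ring
    have h4 : Odd (a * c + b * d) := (ha.mul hc).add_even (hb.mul_right d)
    have h5 : a * c + b * d ≠ 0 := fun h => by simp [h] at h4
    have hk0 : k = 0 := by
      by_contra hk0
      have : 1 ≤ k ^ 2 := by nlinarith [Int.one_le_abs hk0, sq_abs k]
      rw [hk] at h3
      have h6 : 0 < (a * c + b * d) ^ 2 := by positivity
      have h7 : (p : ℤ) ^ 2 ≤ (p : ℤ) ^ 2 * k ^ 2 := le_mul_of_one_le_right (sq_nonneg _) this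
      nlinarith
    rw [hk0, mul_zero, sub_eq_zero] at hk
    apply mul_left_cancel₀ hp0
    nth_rewrite 1 [← h2]
    rw [← h1]
    linear_combination (a * d + c * b) * hk
  have hprod : (p : ℤ) ∣ (a * d - c * b) * (a * (-d) - c * b) :=
    ⟨c ^ 2 - a ^ 2, by linear_combination c ^ 2 * h1 - a ^ 2 * h2⟩
  rcases (Nat.prime_iff_prime_int.mp hp).dvd_or_dvd hprod with h | h
  · exact main d h2 h
  · exact main (-d) (by rw [neg_sq]; exact h2) h

/-- The symmetries leave five unknown numbers. The row sums express the real part `s` of the Jacobi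
sum, and `(1,3)` as well, through `(0,2)`, so it remains to show `s = -u`. -/
theorem cyclotomicNumber_zero_two (hn : n % 8 = 1) (hg : Subgroup.zpowers g = ⊤) {u v : ℤ}
    (huv : (n : ℤ) = u ^ 2 + 4 * v ^ 2) (hu : u ≡ 1 [ZMOD 4]) :
    16 * (cyclotomicNumber g 0 2 : ℤ) = n - 3 + 2 * u ∧
      16 * (cyclotomicNumber g 1 3 : ℤ) = n + 1 - 2 * u := by
  have hJ := jacobi_sq_add_sq hn hg
  set s := ∑ k, ∑ l, (cyclotomicNumber g k l : ℤ) * rePowI (k + l) with hs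
  set t := ∑ k, ∑ l, (cyclotomicNumber g k l : ℤ) * imPowI (k + l)
  have hs' : s = cyclotomicNumber g 0 0 + cyclotomicNumber g 1 3 + cyclotomicNumber g 2 2 +
      cyclotomicNumber g 3 1 - cyclotomicNumber g 0 2 - cyclotomicNumber g 1 1 -
      cyclotomicNumber g 2 0 - cyclotomicNumber g 3 3 := by
    rw [hs]
    simp only [sum_zmod_four]
    rw [show rePowI (0 + 0) = 1 by decide, show rePowI (0 + 1) = 0 by decide,
      show rePowI (0 + 2) = -1 by decide, show rePowI (0 + 3) = 0 by decide,
      show rePowI (1 + 0) = 0 by decide, show rePowI (1 + 1) = -1 by decide,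
      show rePowI (1 + 2) = 0 by decide, show rePowI (1 + 3) = 1 by decide,
      show rePowI (2 + 0) = -1 by decide, show rePowI (2 + 1) = 0 by decide,
      show rePowI (2 + 2) = 1 by decide, show rePowI (2 + 3) = 0 by decide,
      show rePowI (3 + 0) = 0 by decide, show rePowI (3 + 1) = 1 by decide,
      show rePowI (3 + 2) = 0 by decide, show rePowI (3 + 3) = -1 by decide]
    ring
  have r0 := sum_cyclotomicNumber hn hg 0
  have r1 := sum_cyclotomicNumber hn hg 1
  have r2 := sum_cyclotomicNumber hn hg 2
  rw [sum_zmod_four, if_pos rfl] at r0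
  rw [sum_zmod_four, if_neg (by decide)] at r1 r2
  have c10 := cyclotomicNumber_comm (g := g) 1 0
  have c20 := cyclotomicNumber_comm (g := g) 2 0
  have c30 := cyclotomicNumber_comm (g := g) 3 0
  have c21 := cyclotomicNumber_comm (g := g) 2 1
  have c31 := cyclotomicNumber_comm (g := g) 3 1
  have c32 := cyclotomicNumber_comm (g := g) 3 2
  have i11 : cyclotomicNumber g 1 1 = cyclotomicNumber g 3 0 := cyclotomicNumber_inv hn hg 1 1
  have i22 : cyclotomicNumber g 2 2 = cyclotomicNumber g 2 0 := cyclotomicNumber_inv hn hg 2 2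
  have i33 : cyclotomicNumber g 3 3 = cyclotomicNumber g 1 0 := cyclotomicNumber_inv hn hg 3 3
  have i12 : cyclotomicNumber g 1 2 = cyclotomicNumber g 3 1 := cyclotomicNumber_inv hn hg 1 2
  have i13 : cyclotomicNumber g 1 3 = cyclotomicNumber g 3 2 := cyclotomicNumber_inv hn hg 1 3
  have hf : 4 * ((n - 1) / 4) + 1 = n := by omega
  have hf2 : (n - 1) / 4 % 2 = 0 := by omega
  set f := (n - 1) / 4
  -- Since `f` is even, `s ≡ -1 mod 4`; of `u = ± s` only `u = -s` agrees with `u ≡ 1 mod 4`.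
  have hs2 : s = 2 * f - 1 - 8 * cyclotomicNumber g 0 2 := by omega
  have hsodd : Odd s := by
    rw [Int.odd_iff]; omega
  have huodd : Odd u := by
    rw [Int.odd_iff]
    have := hu.eq
    omega
  have hsq : u ^ 2 = s ^ 2 := by
    refine sq_eq_of_sq_add_sq (p := n) Fact.out (b := 2 * v) (d := t) ?_ hJ huodd hsodd
      (even_two_mul v)
    rw [huv]; ring
  have hus : u = -s := by
    have hu' := hu.eq
    rcases sq_eq_sq_iff_eq_or_eq_neg.mp hsq with h | h
    · omega
    · exact h
  constructor <;> omega

end QuarticIndex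

/-! ### Products of Gaussian periods. -/

section Periods

variable {n : ℕ} [Fact n.Prime] {g : (ZMod n)ˣ} {K : Type*} [Field K]

/-- The Gaussian period `∑ ψ x` over the residues `x` of quartic index `k`. -/
noncomputable def quarticPeriod (g : (ZMod n)ˣ) (ψ : AddChar (ZMod n) K) (k : ZMod 4) : K :=
  ∑ x ∈ quarticClass g k, ψ x

lemma sum_addChar_erase_zero {ψ : AddChar (ZMod n) K} (hψ : ψ.IsPrimitive) :
    ∑ x ∈ Finset.univ.erase 0, ψ x = -1 := by
  classical
  have h1 := AddChar.sum_mulShift (1 : ZMod n) hψ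
  simp only [mul_one, one_ne_zero, if_false] at h1
  rw [← Finset.add_sum_erase _ _ (Finset.mem_univ (0 : ZMod n)), AddChar.map_zero_eq_one] at h1
  push_cast at h1
  linear_combination h1

lemma sum_quarticPeriod {ψ : AddChar (ZMod n) K} (hψ : ψ.IsPrimitive) :
    ∑ k, quarticPeriod g ψ k = -1 := by
  rw [← sum_addChar_erase_zero hψ]
  exact sum_quarticClass _

/-- Group the pairs `(a, b)` by `c = a + b` and write `a = c x`, `b = c (1 - x)`. Here `c ≠ 0`,
because `a = -b` would put both in the same class; this is why `k ≠ l` is required and no constant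
term appears. -/
lemma quarticPeriod_mul (hn : n % 8 = 1) (hg : Subgroup.zpowers g = ⊤) (ψ : AddChar (ZMod n) K)
    {k l : ZMod 4} (hkl : k ≠ l) :
    quarticPeriod g ψ k * quarticPeriod g ψ l =
      ∑ m, (cyclotomicNumber g (k - m) (l - m) : K) * quarticPeriod g ψ m := by
  have h1 : ∑ m, (cyclotomicNumber g (k - m) (l - m) : K) * quarticPeriod g ψ m =
      ∑ c ∈ Finset.univ.erase 0, ∑ _x ∈ quarticPairs g (k - quarticIndex g c)
        (l - quarticIndex g c), ψ c := by
    rw [← sum_quarticClass (g := g)]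
    refine Finset.sum_congr rfl fun m _ => ?_
    rw [quarticPeriod, Finset.mul_sum]
    refine Finset.sum_congr rfl fun c hc => ?_
    rw [(mem_quarticClass.mp hc).2, Finset.sum_const, nsmul_eq_mul, cyclotomicNumber]
  rw [h1, Finset.sum_sigma', quarticPeriod, quarticPeriod, Finset.sum_mul_sum,
    ← Finset.sum_product']
  symm
  refine Finset.sum_nbij' (fun s => (s.1 * s.2, s.1 * (1 - s.2)))
    (fun p => ⟨p.1 + p.2, p.1 * (p.1 + p.2)⁻¹⟩) ?_ ?_ ?_ ?_ ?_
  · rintro ⟨c, x⟩ h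
    simp only [Finset.mem_sigma, Finset.mem_erase, Finset.mem_univ, and_true,
      mem_quarticPairs, Finset.mem_product, mem_quarticClass] at *
    obtain ⟨hc, ⟨hx, hx1⟩, h1, h2⟩ := h
    refine ⟨⟨mul_ne_zero hc hx, ?_⟩, ⟨mul_ne_zero hc hx1, ?_⟩⟩
    · rw [quarticIndex_mul hn hg hc hx, h1]; ring
    · rw [quarticIndex_mul hn hg hc hx1, h2]; ring
  · rintro ⟨a, b⟩ h
    simp only [Finset.mem_sigma, Finset.mem_erase, Finset.mem_univ, and_true,
      mem_quarticPairs, Finset.mem_product, mem_quarticClass] at *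
    obtain ⟨⟨ha, hak⟩, ⟨hb, hbl⟩⟩ := h
    have hab : a + b ≠ 0 := by
      intro h
      apply hkl
      rw [← hak, ← hbl, eq_neg_of_add_eq_zero_left h, quarticIndex_neg hn hg]
    have h2 : 1 - a * (a + b)⁻¹ = b * (a + b)⁻¹ := by field_simp; ring
    rw [h2]
    refine ⟨hab, ⟨mul_ne_zero ha (inv_ne_zero hab), mul_ne_zero hb (inv_ne_zero hab)⟩, ?_, ?_⟩
    · rw [quarticIndex_mul hn hg ha (inv_ne_zero hab), quarticIndex_inv hn hg hab, hak]; ring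
    · rw [quarticIndex_mul hn hg hb (inv_ne_zero hab), quarticIndex_inv hn hg hab, hbl]; ring
  · rintro ⟨c, x⟩ h
    simp only [Finset.mem_sigma, Finset.mem_erase] at h
    have hc := h.1.1
    have h2 : c * x + c * (1 - x) = c := by ring
    simp only [h2, Sigma.mk.injEq, heq_eq_eq, true_and]
    field_simp
  · rintro ⟨a, b⟩ h
    simp only [Finset.mem_product, mem_quarticClass] at h
    obtain ⟨⟨ha, hak⟩, ⟨hb, hbl⟩⟩ := h
    have hab : a + b ≠ 0 := by
      intro h
      apply hkl
      rw [← hak, ← hbl, eq_neg_of_add_eq_zero_left h, quarticIndex_neg hn hg]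
    simp only [Prod.mk.injEq]
    constructor
    · field_simp
    · field_simp; ring
  · rintro ⟨c, x⟩ _
    simp only
    rw [← AddChar.map_add_eq_mul]
    congr 1
    ring

/-- By the symmetry of cyclotomic numbers, both products are combinations of `η_0 + η_2` and `η_1 +
η_3` with coefficients `(0,2)` and `(1,3)`, in opposite roles; the two sums are `0` and `-1`. -/
theorem quarticPeriod_products (hn : n % 8 = 1) (hg : Subgroup.zpowers g = ⊤)
    {ψ : AddChar (ZMod n) K} (hψ : ψ.IsPrimitive)
    (h0 : quarticPeriod g ψ 0 + quarticPeriod g ψ 2 = 0) :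
    quarticPeriod g ψ 1 + quarticPeriod g ψ 3 = -1 ∧
    quarticPeriod g ψ 0 * quarticPeriod g ψ 2 = -(cyclotomicNumber g 1 3 : K) ∧
    quarticPeriod g ψ 1 * quarticPeriod g ψ 3 = -(cyclotomicNumber g 0 2 : K) := by
  have h1 := sum_quarticPeriod (g := g) hψ
  rw [sum_zmod_four] at h1
  have h13 : quarticPeriod g ψ 1 + quarticPeriod g ψ 3 = -1 := by linear_combination h1 - h0
  have m02 := quarticPeriod_mul hn hg ψ (k := 0) (l := 2) (by decide)
  have m13 := quarticPeriod_mul hn hg ψ (k := 1) (l := 3) (by decide)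
  rw [sum_zmod_four] at m02 m13
  rw [show (0 - 0 : ZMod 4) = 0 by decide, show (2 - 0 : ZMod 4) = 2 by decide,
    show (0 - 1 : ZMod 4) = 3 by decide, show (2 - 1 : ZMod 4) = 1 by decide,
    show (0 - 2 : ZMod 4) = 2 by decide, show (2 - 2 : ZMod 4) = 0 by decide,
    show (0 - 3 : ZMod 4) = 1 by decide, show (2 - 3 : ZMod 4) = 3 by decide,
    cyclotomicNumber_comm 2 0, cyclotomicNumber_comm 3 1] at m02
  rw [show (1 - 0 : ZMod 4) = 1 by decide, show (3 - 0 : ZMod 4) = 3 by decide,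
    show (1 - 1 : ZMod 4) = 0 by decide, show (3 - 1 : ZMod 4) = 2 by decide,
    show (1 - 2 : ZMod 4) = 3 by decide, show (3 - 2 : ZMod 4) = 1 by decide,
    show (1 - 3 : ZMod 4) = 2 by decide, show (3 - 3 : ZMod 4) = 0 by decide,
    cyclotomicNumber_comm 2 0, cyclotomicNumber_comm 3 1] at m13
  refine ⟨h13, ?_, ?_⟩
  · linear_combination m02 + (cyclotomicNumber g 0 2 : K) * h0 + (cyclotomicNumber g 1 3 : K) * h13
  · linear_combination m13 + (cyclotomicNumber g 1 3 : K) * h0 + (cyclotomicNumber g 0 2 : K) * h13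

end Periods

/-! ### Fourier transform on `ZMod n` and the square root bound. -/

section Fourier

variable {n : ℕ} [Fact n.Prime] {g : (ZMod n)ˣ} {K : Type*} [Field K]

/-- The Fourier coefficient `∑ x, f x ψ(j x)`. -/
def discreteFourier (ψ : AddChar (ZMod n) K) (f : ZMod n → K) (j : ZMod n) : K :=
  ∑ x, f x * ψ (j * x)

open Classical in
/-- The support of a function on `ZMod n`. -/
noncomputable def suppFinset (f : ZMod n → K) : Finset
  (ZMod n) := Finset.univ.filter fun x => f x ≠ 0

lemma mem_suppFinset {f : ZMod n → K} {x : ZMod n} : x ∈ suppFinset f ↔ f x ≠ 0 := by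
  simp [suppFinset]

lemma discreteFourier_zero (ψ : AddChar (ZMod n) K) (f : ZMod n → K) :
    discreteFourier ψ f 0 = ∑ x, f x := by
  simp [discreteFourier]

lemma fourier_inversion {ψ : AddChar (ZMod n) K} (hψ : ψ.IsPrimitive) (f : ZMod n → K)
    (x : ZMod n) : ∑ j, discreteFourier ψ f j * ψ (-(j * x)) = n * f x := by
  classical
  simp only [discreteFourier, Finset.sum_mul]
  rw [Finset.sum_comm]
  have h : ∀ y, ∑ j, f y * ψ (j * y) * ψ (-(j * x)) = f y * if y = x then (n : K) else 0 := by
    intro y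
    have := AddChar.sum_mulShift (y - x) hψ
    simp only [ZMod.card, sub_eq_zero, Nat.cast_ite, Nat.cast_zero] at this
    rw [← this, Finset.mul_sum]
    refine Finset.sum_congr rfl fun j _ => ?_
    rw [mul_assoc, ← AddChar.map_add_eq_mul]
    congr 2
    ring
  rw [Finset.sum_congr rfl fun y _ => h y]
  simp [mul_comm]

/-- The square root bound for odd-like words. -/
theorem card_le_sq_of_sum_ne_zero {ψ : AddChar (ZMod n) K} (hψ : ψ.IsPrimitive) {f : ZMod n → K}
    (a : ZMod n) (hf : ∀ j ≠ 0, discreteFourier ψ f j * discreteFourier ψ f (a * j) = 0)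
    (h0 : ∑ x, f x ≠ 0) : n ≤ (suppFinset f).card ^ 2 := by
  classical
  -- The product of the transform with its dilate by `a` is supported at 0, so its inverse transform
  -- is a nonzero constant. That transform is also a convolution, which vanishes at any `x` not of
  -- the form `y + a z` with `y, z` in the support.
  have key : ∀ x, ∃ p ∈ suppFinset f ×ˢ suppFinset f, p.1 + a * p.2 = x := by
    intro x
    by_contra hcon
    push Not at hcon
    have h1 : ∑ j, discreteFourier ψ f j * discreteFourier ψ f (a * j) * ψ (-(j * x)) =
        (∑ x, f x) ^ 2 := by
      rw [Finset.sum_eq_single 0]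
      · simp [discreteFourier_zero, sq]
      · intro j _ hj
        rw [hf j hj, zero_mul]
      · simp
    have h2 : ∑ j, discreteFourier ψ f j * discreteFourier ψ f (a * j) * ψ (-(j * x)) =
        ∑ y, ∑ z, f y * f z * ∑ j, ψ (j * (y + a * z - x)) := by
      simp only [Finset.mul_sum]
      rw [Finset.sum_comm_cycle]
      refine Finset.sum_congr rfl fun j _ => ?_
      simp only [discreteFourier]
      rw [Finset.sum_mul_sum, Finset.sum_mul]
      refine Finset.sum_congr rfl fun y _ => ?_
      rw [Finset.sum_mul]
      refine Finset.sum_congr rfl fun z _ => ?_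
      rw [show j * (y + a * z - x) = j * y + a * j * z + -(j * x) by ring, AddChar.map_add_eq_mul,
        AddChar.map_add_eq_mul]
      ring
    rw [h1] at h2
    apply h0
    apply pow_eq_zero_iff (two_ne_zero) |>.mp
    rw [h2]
    refine Finset.sum_eq_zero fun y _ => Finset.sum_eq_zero fun z _ => ?_
    by_cases hy : f y = 0
    · simp [hy]
    by_cases hz : f z = 0
    · simp [hz]
    have h3 := hcon (y, z) (Finset.mem_product.mpr ⟨mem_suppFinset.mpr hy, mem_suppFinset.mpr hz⟩)
    rw [AddChar.sum_mulShift _ hψ, if_neg (sub_ne_zero.mpr h3)]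
    simp
  have hsurj : (Finset.univ : Finset (ZMod n)) ⊆
      (suppFinset f ×ˢ suppFinset f).image (fun p => p.1 + a * p.2) := by
    intro x _
    obtain ⟨p, hp, rfl⟩ := key x
    exact Finset.mem_image_of_mem _ hp
  calc n = (Finset.univ : Finset (ZMod n)).card := by rw [Finset.card_univ, ZMod.card]
    _ ≤ _ := Finset.card_le_card hsurj
    _ ≤ _ := Finset.card_image_le
    _ = _ := by rw [Finset.card_product, sq]

/-! ### Quadratic Gauss sums and the Gleason–Prange argument. -/

/-- The quadratic character on quartic indices. -/
def signIndex (k : ZMod 4) : ℤ := if k = 0 ∨ k = 2 then 1 else -1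

/-- The quadratic character with values in `K`. -/
noncomputable def quadSign (g : (ZMod n)ˣ) (K : Type*) [Field K] (x : ZMod n) : K :=
  if x = 0 then 0 else (signIndex (quarticIndex g x) : K)

lemma signIndex_add (k l : ZMod 4) : signIndex (k + l) = signIndex k * signIndex l := by
  revert k l; decide

lemma signIndex_neg (k : ZMod 4) : signIndex (-k) = signIndex k := by
  revert k; decide

lemma signIndex_eq (k : ZMod 4) : signIndex k = 1 ∨ signIndex k = -1 := by
  revert k; decide

/-- The involution `x ↦ -r / (j x)` fixes `j x - r / x` and, as `j r` is a nonsquare, flips the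
quadratic sign. Terms cancel in pairs, in any characteristic, since the sign flip also rules out
fixed points. -/
lemma sum_quadSign_mul_eq_zero (hn : n % 8 = 1) (hg : Subgroup.zpowers g = ⊤)
    (ψ : AddChar (ZMod n) K) {j r : ZMod n} (hj : j ≠ 0) (hr : r ≠ 0)
    (hj' : signIndex (quarticIndex g j) = -1) (hr' : signIndex (quarticIndex g r) = 1) :
    ∑ x, quadSign g K x * ψ (j * x - r * x⁻¹) = 0 := by
  classical
  have hrj : -(r * j⁻¹) ≠ 0 := neg_ne_zero.mpr (mul_ne_zero hr (inv_ne_zero hj))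
  have hs : ∀ x : ZMod n, x ≠ 0 →
      signIndex (quarticIndex g (-(r * j⁻¹) * x⁻¹)) = - signIndex (quarticIndex g x) := by
    intro x hx
    rw [quarticIndex_mul hn hg hrj (inv_ne_zero hx), quarticIndex_neg hn hg,
      quarticIndex_mul hn hg hr (inv_ne_zero hj), quarticIndex_inv hn hg hj,
      quarticIndex_inv hn hg hx, signIndex_add, signIndex_add, signIndex_neg, signIndex_neg,
      hj', hr']
    ring
  rw [← Finset.sum_erase (a := 0) _ (by simp [quadSign])]
  refine Finset.sum_involution (fun x _ => -(r * j⁻¹) * x⁻¹) ?_ ?_ ?_ ?_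
  · intro x hx
    have hx := (Finset.mem_erase.mp hx).1
    have h1 : j * (-(r * j⁻¹) * x⁻¹) - r * (-(r * j⁻¹) * x⁻¹)⁻¹ = j * x - r * x⁻¹ := by
      field_simp
      ring
    rw [quadSign, quadSign, if_neg hx, if_neg (mul_ne_zero hrj (inv_ne_zero hx)), hs x hx, h1]
    push_cast
    ring
  · intro x hx _ h
    have hx := (Finset.mem_erase.mp hx).1
    have h1 := hs x hx
    rw [h] at h1
    rcases signIndex_eq (quarticIndex g x) with h2 | h2 <;> rw [h2] at h1 <;> norm_num at h1
  · intro x hx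
    have hx := (Finset.mem_erase.mp hx).1
    exact Finset.mem_erase.mpr ⟨mul_ne_zero hrj (inv_ne_zero hx), Finset.mem_univ _⟩
  · intro x hx
    have hx := (Finset.mem_erase.mp hx).1
    field_simp

/-- Substitute `x ↦ -r / x`, which keeps the sign because `-r` is a square. -/
lemma sum_quadSign_inv (hn : n % 8 = 1) (hg : Subgroup.zpowers g = ⊤)
    (ψ : AddChar (ZMod n) K) {r : ZMod n} (hr : r ≠ 0)
    (hr' : signIndex (quarticIndex g r) = 1) :
    ∑ x, quadSign g K x * ψ (-(r * x⁻¹)) = ∑ x, quadSign g K x * ψ x := by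
  classical
  rw [← Finset.sum_erase (a := 0) _ (by simp [quadSign]),
    ← Finset.sum_erase (a := 0) (Finset.univ) (f := fun x => quadSign g K x * ψ x)
      (by simp [quadSign])]
  have hne : ∀ x : ZMod n, x ≠ 0 → -(r * x⁻¹) ≠ 0 := fun x hx =>
    neg_ne_zero.mpr (mul_ne_zero hr (inv_ne_zero hx))
  refine Finset.sum_nbij' (fun x => -(r * x⁻¹)) (fun x => -(r * x⁻¹)) ?_ ?_ ?_ ?_ ?_
  · intro x hx
    exact Finset.mem_erase.mpr ⟨hne x (Finset.mem_erase.mp hx).1, Finset.mem_univ _⟩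
  · intro x hx
    exact Finset.mem_erase.mpr ⟨hne x (Finset.mem_erase.mp hx).1, Finset.mem_univ _⟩
  · intro x hx
    have hx := (Finset.mem_erase.mp hx).1
    field_simp
  · intro x hx
    have hx := (Finset.mem_erase.mp hx).1
    field_simp
  · intro x hx
    have hx := (Finset.mem_erase.mp hx).1
    congr 1
    rw [quadSign, quadSign, if_neg hx, if_neg (hne x hx), quarticIndex_neg hn hg,
      quarticIndex_mul hn hg hr (inv_ne_zero hx), quarticIndex_inv hn hg hx, signIndex_add,
      signIndex_neg, hr', one_mul]

/-- The square root bound for all nonzero words of a quadratic residue code. The even-like words are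
reduced to odd-like ones by the Gleason–Prange transformation. -/
theorem card_le_sq_of_nonsquare_zeros (hn : n % 8 = 1) (hg : Subgroup.zpowers g = ⊤)
    {ψ : AddChar (ZMod n) K} (hψ : ψ.IsPrimitive) (hnK : (n : K) ≠ 0)
    (hG : ∑ x, quadSign g K x * ψ x ≠ 0) {f : ZMod n → K} (hf0 : f ≠ 0)
    (hf : ∀ j ≠ 0, signIndex (quarticIndex g j) = -1 → discreteFourier ψ f j = 0) :
    n ≤ (suppFinset f).card ^ 2 := by
  classical
  have odd : ∀ f : ZMod n → K,
      (∀ j ≠ 0, signIndex (quarticIndex g j) = -1 → discreteFourier ψ f j = 0) →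
      ∑ x, f x ≠ 0 → n ≤ (suppFinset f).card ^ 2 := by
    intro f hf hs
    -- The multiplier `g` is a nonsquare, so one of `j` and `g j` is always a zero.
    refine card_le_sq_of_sum_ne_zero hψ (g : ZMod n) (fun j hj => ?_) hs
    rcases signIndex_eq (quarticIndex g j) with h | h
    · rw [hf (g * j) (mul_ne_zero (Units.ne_zero g) hj), mul_zero]
      rw [quarticIndex_mul hn hg (Units.ne_zero g) hj, quarticIndex_generator hn hg,
        signIndex_add, h]
      decide
    · rw [hf j hj h, zero_mul]
  by_cases hs : ∑ x, f x = 0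
  swap
  · exact odd f hf hs
  obtain ⟨t, ht⟩ := Function.ne_iff.mp hf0
  -- The twist by `x ↦ t + x⁻¹` moves the point `t`, where `f` is nonzero, to infinity. `F` keeps
  -- the nonsquare zeros, has support no larger than that of `f`, and its coordinate sum is `f t`
  -- times the Gauss sum.
  set F : ZMod n → K := fun x => quadSign g K x * f (t + x⁻¹) with hF
  have hcoef : ∀ j, (n : K) * discreteFourier ψ F j =
      ∑ r, discreteFourier ψ f r * ψ (-(r * t)) *
        ∑ x, quadSign g K x * ψ (j * x - r * x⁻¹) := by
    intro j
    simp only [Finset.mul_sum]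
    rw [Finset.sum_comm, discreteFourier, Finset.mul_sum]
    refine Finset.sum_congr rfl fun x _ => ?_
    rw [hF]
    have := fourier_inversion hψ f (t + x⁻¹)
    calc (n : K) * (quadSign g K x * f (t + x⁻¹) * ψ (j * x))
        = quadSign g K x * ψ (j * x) * (n * f (t + x⁻¹)) := by ring
      _ = _ := by
        rw [← this, Finset.mul_sum]
        refine Finset.sum_congr rfl fun r _ => ?_
        rw [show -(r * (t + x⁻¹)) = -(r * t) + -(r * x⁻¹) by ring, AddChar.map_add_eq_mul,
          sub_eq_add_neg, AddChar.map_add_eq_mul]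
        ring
  have hF1 : ∀ j ≠ 0, signIndex (quarticIndex g j) = -1 → discreteFourier ψ F j = 0 := by
    intro j hj hj'
    apply (mul_eq_zero.mp (?_ : (n : K) * discreteFourier ψ F j = 0)).resolve_left hnK
    rw [hcoef]
    refine Finset.sum_eq_zero fun r _ => ?_
    by_cases hr : r = 0
    · rw [hr, discreteFourier_zero, hs, zero_mul, zero_mul]
    rcases signIndex_eq (quarticIndex g r) with h | h
    · rw [sum_quadSign_mul_eq_zero hn hg ψ hj hr hj' h, mul_zero]
    · rw [hf r hr h, zero_mul, zero_mul]
  have hF2 : ∑ x, F x ≠ 0 := by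
    rw [← discreteFourier_zero ψ]
    apply right_ne_zero_of_mul (a := (n : K))
    rw [hcoef]
    have h1 : ∀ r, discreteFourier ψ f r * ψ (-(r * t)) *
        ∑ x, quadSign g K x * ψ (0 * x - r * x⁻¹) =
        discreteFourier ψ f r * ψ (-(r * t)) * ∑ x, quadSign g K x * ψ x := by
      intro r
      by_cases hr : r = 0
      · rw [hr, discreteFourier_zero, hs, zero_mul, zero_mul, zero_mul]
      rcases signIndex_eq (quarticIndex g r) with h | h
      · simp only [zero_mul, zero_sub]
        rw [sum_quadSign_inv hn hg ψ hr h]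
      · rw [hf r hr h, zero_mul, zero_mul, zero_mul]
    rw [Finset.sum_congr rfl fun r _ => h1 r, ← Finset.sum_mul, fourier_inversion hψ]
    exact mul_ne_zero (mul_ne_zero hnK ht) hG
  refine (odd F hF1 hF2).trans (Nat.pow_le_pow_left ?_ 2)
  refine Finset.card_le_card_of_injOn (fun x => t + x⁻¹) ?_ ?_
  · intro x hx
    rw [Finset.mem_coe, mem_suppFinset] at *
    exact right_ne_zero_of_mul hx
  · intro x _ y _ h
    exact inv_injective (add_left_cancel h)

lemma sum_quadSign (ψ : AddChar (ZMod n) K) :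
    ∑ x, quadSign g K x * ψ x =
      quarticPeriod g ψ 0 + quarticPeriod g ψ 2 - (quarticPeriod g ψ 1 + quarticPeriod g ψ 3) := by
  classical
  rw [← Finset.sum_erase (a := 0) _ (by simp [quadSign]), ← sum_quarticClass (g := g),
    sum_zmod_four]
  have h : ∀ k, ∑ x ∈ quarticClass g k, quadSign g K x * ψ x =
      (signIndex k : K) * quarticPeriod g ψ k := by
    intro k
    rw [quarticPeriod, Finset.mul_sum]
    refine Finset.sum_congr rfl fun x hx => ?_
    rw [mem_quarticClass] at hx
    rw [quadSign, if_neg hx.1, hx.2]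
  rw [h, h, h, h, show signIndex 0 = 1 by decide, show signIndex 1 = -1 by decide,
    show signIndex 2 = 1 by decide, show signIndex 3 = -1 by decide]
  push_cast
  ring

end Fourier

/-! ### Translation between words, transforms and periods. -/

section Bridge

variable {n : ℕ} [Fact n.Prime] {g : (ZMod n)ˣ} {F K : Type*} [Field F] [Field K] [Algebra F K]

/-- The additive character `x ↦ η ^ x` of `ZMod n`. -/
noncomputable def rootChar {η : K} (hη : IsPrimitiveRoot η n) : AddChar (ZMod n) K :=
  AddChar.zmodChar n hη.pow_eq_one

lemma rootChar_apply {η : K} (hη : IsPrimitiveRoot η n) (x : ZMod n) :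
    rootChar hη x = η ^ x.val := AddChar.zmodChar_apply _ _

lemma rootChar_natCast {η : K} (hη : IsPrimitiveRoot η n) (a : ℕ) :
    rootChar hη (a : ZMod n) = η ^ a := AddChar.zmodChar_apply' _ _

lemma rootChar_isPrimitive {η : K} (hη : IsPrimitiveRoot η n) : (rootChar hη).IsPrimitive :=
  AddChar.zmodChar_primitive_of_primitive_root n hη

lemma etaPeriod_eq (hn : n % 8 = 1) (hg : Subgroup.zpowers g = ⊤) {η : K}
    (hη : IsPrimitiveRoot η n) (k : ℕ) :
    etaPeriod g η k = quarticPeriod g (rootChar hη) k := by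
  rw [etaPeriod, quarticPeriod, cyclotomicClass_eq hn hg]
  exact Finset.sum_congr rfl fun x _ => (rootChar_apply hη x).symm

/-- A word over `F`, read as a function on `ZMod n` with values in `K`. -/
def wordFun (K : Type*) [Field K] [Algebra F K] (c : Fin n → F) (x : ZMod n) : K :=
  algebraMap F K (c ⟨x.val, x.val_lt⟩)

lemma sum_fin_eq_sum_zmod {M : Type*} [AddCommMonoid M] (f : Fin n → M) :
    ∑ i, f i = ∑ x : ZMod n, f ⟨x.val, x.val_lt⟩ := by
  symm
  refine Finset.sum_nbij' (fun x => ⟨x.val, x.val_lt⟩) (fun i => ((i : ℕ) : ZMod n)) ?_ ?_ ?_ ?_ ?_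
  · intros; exact Finset.mem_univ _
  · intros; exact Finset.mem_univ _
  · intro x _; simp
  · intro i _
    ext
    simp [ZMod.val_natCast, Nat.mod_eq_of_lt i.2]
  · intros; rfl

lemma eval_wordPoly {η : K} (hη : IsPrimitiveRoot η n) (c : Fin n → F) (j : ZMod n) :
    ((wordPoly F n c).map (algebraMap F K)).eval (η ^ j.val) =
      discreteFourier (rootChar hη) (wordFun K c) j := by
  rw [wordPoly_apply, Polynomial.map_sum, Polynomial.eval_finsetSum, sum_fin_eq_sum_zmod,
    discreteFourier]
  refine Finset.sum_congr rfl fun x _ => ?_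
  rw [Polynomial.map_monomial, Polynomial.eval_monomial, ← pow_mul, ← rootChar_natCast hη]
  simp [wordFun]

lemma wordPoly_seq {n : ℕ} (s : ℕ → F) : wordPoly F n (fun i => s i) = seqPoly n s := by
  rw [wordPoly_apply, seqPoly, Finset.sum_range]

lemma cycSeq_periodic (ρ : F) (i : ℕ) : cycSeq g ρ (i + n) = cycSeq g ρ i := by
  simp [cycSeq]

/-- One period of the sequence is `ρ` at 0, plus the indicator of the nonzero residues, minus that
of `C_0`; at `j ≠ 0` the last two contribute `-1` and `-η_k`. -/
lemma eval_cycSeq (hn : n % 8 = 1) (hg : Subgroup.zpowers g = ⊤) {η : K}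
    (hη : IsPrimitiveRoot η n) (hf : (((n - 1) / 4 : ℕ) : K) = 0) (ρ : F) (j : ZMod n) :
    ((seqPoly n (cycSeq g ρ)).map (algebraMap F K)).eval (η ^ j.val) =
      if j = 0 then algebraMap F K ρ
      else algebraMap F K ρ - 1 - quarticPeriod g (rootChar hη) (quarticIndex g j) := by
  classical
  set ψ := rootChar hη with hψ
  have hprim : ψ.IsPrimitive := rootChar_isPrimitive hη
  rw [← wordPoly_seq, eval_wordPoly hη, discreteFourier]
  have h1 : ∀ x : ZMod n, wordFun K (fun i : Fin n => cycSeq g ρ i) x * ψ (j * x) =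
      (if x = 0 then algebraMap F K ρ else 0) + (if x ∈ Finset.univ.erase 0 then ψ (j * x) else 0) -
        (if x ∈ quarticClass g 0 then ψ (j * x) else 0) := by
    intro x
    have hx : ((x.val : ℕ) : ZMod n) = x := by simp
    have hC : x ∈ cyclotomicClass 4 g 0 ↔ x ∈ quarticClass g 0 := by
      rw [cyclotomicClass_eq hn hg, Nat.cast_zero]
    simp only [wordFun, cycSeq, hx, hC]
    by_cases h0 : x = 0
    · simp [h0, mem_quarticClass]
    · by_cases hc : x ∈ quarticClass g 0 <;> simp [h0, hc]
  rw [Finset.sum_congr rfl fun x _ => h1 x, Finset.sum_sub_distrib, Finset.sum_add_distrib,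
    Finset.sum_ite_eq' Finset.univ (0 : ZMod n), if_pos (Finset.mem_univ _),
    Finset.sum_ite_mem, Finset.sum_ite_mem, Finset.univ_inter, Finset.univ_inter]
  split_ifs with hj
  -- At `j = 0` the two indicators contribute their cardinalities, both zero in `K`.
  · have hn4 : n - 1 = 4 * ((n - 1) / 4) := by omega
    have hcard : ((n - 1 : ℕ) : K) = 0 := by rw [hn4, Nat.cast_mul, hf, mul_zero]
    simp only [hj, zero_mul, AddChar.map_zero_eq_one, Finset.sum_const, card_quarticClass hn hg,
      nsmul_eq_mul, mul_one, hf, Finset.card_erase_of_mem (Finset.mem_univ _), Finset.card_univ,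
      ZMod.card, hcard]
    ring
  · have h2 : ∑ x ∈ Finset.univ.erase 0, ψ (j * x) = -1 := by
      rw [← sum_addChar_erase_zero hprim]
      refine Finset.sum_nbij' (fun x => j * x) (fun x => j⁻¹ * x) ?_ ?_ ?_ ?_ ?_
      · intro x hx
        exact Finset.mem_erase.mpr ⟨mul_ne_zero hj (Finset.mem_erase.mp hx).1, Finset.mem_univ _⟩
      · intro x hx
        exact Finset.mem_erase.mpr
          ⟨mul_ne_zero (inv_ne_zero hj) (Finset.mem_erase.mp hx).1, Finset.mem_univ _⟩
      · intro x _; exact inv_mul_cancel_left₀ hj x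
      · intro x _; exact mul_inv_cancel_left₀ hj x
      · intros; rfl
    rw [h2, sum_quarticClass_mul hn hg _ hj, add_zero, quarticPeriod]
    ring

/-! ### Zero sets as unions of quartic classes. -/

open Classical in
/-- The residues whose quartic index lies in `T`, together with `0` if `b` holds. -/
noncomputable def classUnion (g : (ZMod n)ˣ) (b : Bool) (T : Finset (ZMod 4)) : Finset (ZMod n) :=
  Finset.univ.filter fun x => if x = 0 then b = true else quarticIndex g x ∈ T

lemma mem_classUnion {b : Bool} {T : Finset (ZMod 4)} {x : ZMod n} :
    x ∈ classUnion g b T ↔ if x = 0 then b = true else quarticIndex g x ∈ T := by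
  simp [classUnion]

lemma compl_classUnion (b : Bool) (T : Finset (ZMod 4)) :
    (classUnion g b T)ᶜ = classUnion g (!b) Tᶜ := by
  ext x
  rw [Finset.mem_compl, mem_classUnion, mem_classUnion]
  split_ifs <;> simp

lemma prod_classUnion {M : Type*} [CommMonoid M] (f : ZMod n → M) (b : Bool)
    (T : Finset (ZMod 4)) :
    ∏ x ∈ classUnion g b T, f x =
      (if b = true then f 0 else 1) * ∏ k ∈ T, ∏ x ∈ quarticClass g k, f x := by
  classical
  have h1 : classUnion g b T = (if b = true then {0} else ∅) ∪ T.biUnion (quarticClass g) := by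
    ext x
    rw [mem_classUnion, Finset.mem_union, Finset.mem_biUnion]
    by_cases hx : x = 0
    · cases b <;> simp [hx, mem_quarticClass]
    · cases b <;> simp [hx, mem_quarticClass]
  rw [h1, Finset.prod_union, Finset.prod_biUnion]
  · split_ifs <;> simp
  · intro k _ l _ hkl
    simp only [Function.onFun]
    rw [Finset.disjoint_left]
    intro x hx hx'
    rw [mem_quarticClass] at hx hx'
    exact hkl (hx.2.symm.trans hx'.2)
  · rw [Finset.disjoint_left]
    intro x hx hx'
    rw [Finset.mem_biUnion] at hx'
    obtain ⟨k, -, hk⟩ := hx'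
    rw [mem_quarticClass] at hk
    split_ifs at hx
    · exact hk.1 (Finset.mem_singleton.mp hx)
    · simp at hx

lemma card_classUnion (hn : n % 8 = 1) (hg : Subgroup.zpowers g = ⊤) (b : Bool)
    (T : Finset (ZMod 4)) :
    (classUnion g b T).card = (if b = true then 1 else 0) + T.card * ((n - 1) / 4) := by
  -- Cardinality is obtained as a product in the multiplicative copy of the natural numbers.
  have h := prod_classUnion (g := g) (fun _ => Multiplicative.ofAdd 1) b T
  have h2 := congrArg Multiplicative.toAdd h
  cases b <;> simpa [card_quarticClass hn hg] using h2

lemma prod_classUnion_eq_Omega (hn : n % 8 = 1) (hg : Subgroup.zpowers g = ⊤) (η : K) (b : Bool)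
    (T : Finset (ZMod 4)) :
    ∏ j ∈ classUnion g b T, (X - C (η ^ j.val)) =
      (if b = true then X - 1 else 1) * ∏ k ∈ T, Omega g η k.val := by
  rw [prod_classUnion]
  congr 1
  · simp
  · refine Finset.prod_congr rfl fun k _ => ?_
    rw [Omega, cyclotomicClass_eq hn hg, ZMod.natCast_zmod_val]

/-- The zeros of the polynomial of the sequence, in terms of the values of the periods. -/
lemma mem_classUnion_iff_eval (hn : n % 8 = 1) (hg : Subgroup.zpowers g = ⊤) {η : K}
    (hη : IsPrimitiveRoot η n) (hf : (((n - 1) / 4 : ℕ) : K) = 0) {ρ : F} {b : Bool}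
    (hb : b = true ↔ ρ = 0) {T : Finset (ZMod 4)}
    (hT : ∀ k, k ∈ T ↔ quarticPeriod g (rootChar hη) k = algebraMap F K ρ - 1) (j : ZMod n) :
    j ∈ classUnion g b T ↔
      ((seqPoly n (cycSeq g ρ)).map (algebraMap F K)).eval (η ^ j.val) = 0 := by
  rw [mem_classUnion, eval_cycSeq hn hg hη hf]
  split_ifs with hj
  · rw [hb, map_eq_zero]
  · rw [hT, sub_eq_zero]
    exact eq_comm

lemma mem_seqCode_iff_discreteFourier {η : K} (hη : IsPrimitiveRoot η n) {s : ℕ → F}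
    {S : Finset (ZMod n)}
    (hS : ∀ j, j ∈ S ↔ ((seqPoly n s).map (algebraMap F K)).eval (η ^ j.val) = 0) {c : Fin n → F} :
    c ∈ seqCode n s ↔ ∀ j ∉ S, discreteFourier (rootChar hη) (wordFun K c) j = 0 := by
  rw [mem_seqCode_iff hη S hS]
  simp only [eval_wordPoly hη]

open Classical in
lemma hammingNorm_eq_card_suppFinset (c : Fin n → F) :
    hammingNorm c = (suppFinset (wordFun K c)).card := by
  rw [hammingNorm]
  refine Finset.card_nbij' (fun i => ((i : ℕ) : ZMod n)) (fun x => ⟨x.val, x.val_lt⟩) ?_ ?_ ?_ ?_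
  · intro i hi
    rw [Finset.mem_coe, Finset.mem_filter] at hi
    have h : (⟨((i : ℕ) : ZMod n).val, ZMod.val_lt _⟩ : Fin n) = i := by
      ext; simp [ZMod.val_natCast, Nat.mod_eq_of_lt i.2]
    rw [Finset.mem_coe, mem_suppFinset, wordFun, h]
    simpa using hi.2
  · intro x hx
    rw [Finset.mem_coe, mem_suppFinset, wordFun] at hx
    simpa using hx
  · intro i _
    ext; simp [ZMod.val_natCast, Nat.mod_eq_of_lt i.2]
  · intro x _; simp

lemma wordFun_ne_zero {c : Fin n → F} (hc : c ≠ 0) : wordFun K c ≠ 0 := by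
  classical
  intro h
  have h1 := hammingNorm_eq_card_suppFinset (K := K) c
  have h2 : suppFinset (wordFun K c) = ∅ := by
    ext x; simp [mem_suppFinset, h]
  rw [h2, Finset.card_empty, hammingNorm_eq_zero] at h1
  exact hc h1

lemma sum_wordFun (c : Fin n → F) : ∑ x, wordFun K c x = algebraMap F K (∑ i, c i) := by
  rw [map_sum, sum_fin_eq_sum_zmod]
  rfl

/-! ### Minimum weights, duadic codes and quadratic residue codes. -/

open Classical in
lemma minWeightGE_of_forall {n : ℕ} {C : Submodule F (Fin n → F)} {b : ℝ} (hC : C ≠ ⊥)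
    (h : ∀ c ∈ C, c ≠ 0 → b ≤ (hammingNorm c : ℝ)) : MinWeightGE C b := by
  obtain ⟨c, hc, hc0⟩ := Submodule.exists_mem_ne_zero_of_ne_bot hC
  have hne : {w : ℕ | ∃ c ∈ C, c ≠ 0 ∧ hammingNorm c = w}.Nonempty := ⟨_, c, hc, hc0, rfl⟩
  refine ⟨sInf _, ⟨Nat.sInf_mem hne, fun w hw => Nat.sInf_le hw⟩, ?_⟩
  obtain ⟨c', hc', hc0', hw⟩ := Nat.sInf_mem hne
  rw [← hw]
  exact h c' hc' hc0'

open Classical in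
lemma minOddLikeWeightGE_of_forall {n : ℕ} {C : Submodule F (Fin n → F)} {b : ℝ}
    (hC : ∃ c ∈ C, ∑ i, c i ≠ 0)
    (h : ∀ c ∈ C, ∑ i, c i ≠ 0 → b ≤ (hammingNorm c : ℝ)) : MinOddLikeWeightGE C b := by
  obtain ⟨c, hc, hc0⟩ := hC
  have hne : {w : ℕ | ∃ c ∈ C, ∑ i, c i ≠ 0 ∧ hammingNorm c = w}.Nonempty := ⟨_, c, hc, hc0, rfl⟩
  refine ⟨sInf _, ⟨Nat.sInf_mem hne, fun w hw => Nat.sInf_le hw⟩, ?_⟩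
  obtain ⟨c', hc', hc0', hw⟩ := Nat.sInf_mem hne
  rw [← hw]
  exact h c' hc' hc0'

lemma sqrt_le_of_le_sq {a w : ℕ} (h : a ≤ w ^ 2) : Real.sqrt a ≤ (w : ℝ) := by
  rw [Real.sqrt_le_left (Nat.cast_nonneg _)]
  exact_mod_cast h

lemma discreteFourier_wordFun_one {η : K} (hη : IsPrimitiveRoot η n) {j : ZMod n} (hj : j ≠ 0) :
    discreteFourier (rootChar hη) (wordFun K (1 : Fin n → F)) j = 0 := by
  classical
  have h := AddChar.sum_mulShift j (rootChar_isPrimitive hη)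
  rw [if_neg hj, Nat.cast_zero] at h
  rw [← h, discreteFourier]
  refine Finset.sum_congr rfl fun x _ => ?_
  simp [wordFun, mul_comm j x]

lemma seqCode_ne_bot_of_given {n : ℕ} {s : ℕ → F} {D : K[X]} {L : ℕ} (h : SeqAndCodeGivenBy n s D L)
    (hL : L < n) : seqCode n s ≠ ⊥ := by
  obtain ⟨M, -, -, -, -, -, hr⟩ := h
  intro h0
  rw [h0, finrank_bot] at hr
  omega

lemma one_mem_seqCode {η : K} (hη : IsPrimitiveRoot η n) {s : ℕ → F} {S : Finset (ZMod n)}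
    (hS : ∀ j, j ∈ S ↔ ((seqPoly n s).map (algebraMap F K)).eval (η ^ j.val) = 0)
    (h0 : (0 : ZMod n) ∈ S) : (1 : Fin n → F) ∈ seqCode n s := by
  rw [mem_seqCode_iff_discreteFourier hη hS]
  exact fun j hj => discreteFourier_wordFun_one hη fun h => hj (h ▸ h0)

/-- If the check polynomial is `x - 1`, the code is the repetition code. -/
lemma isMinWeight_repetition {η : K} (hη : IsPrimitiveRoot η n) {s : ℕ → F} (hnK : (n : K) ≠ 0)
    (hS : ∀ j, j ∈ ({0} : Finset (ZMod n)) ↔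
      ((seqPoly n s).map (algebraMap F K)).eval (η ^ j.val) = 0) :
    IsMinWeight (seqCode n s) n := by
  classical
  have hfull : ∀ c ∈ seqCode n s, c ≠ 0 → (suppFinset (wordFun K c)).card = n := by
    intro c hc hc0
    rw [mem_seqCode_iff_discreteFourier hη hS] at hc
    -- Only the coefficient at 0 survives, so every word is constant.
    have h1 : ∀ x, (n : K) * wordFun K c x = discreteFourier (rootChar hη) (wordFun K c) 0 := by
      intro x
      rw [← fourier_inversion (rootChar_isPrimitive hη), Finset.sum_eq_single 0]
      · simp
      · intro j _ hj
        rw [hc j (by simpa using hj), zero_mul]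
      · simp
    have h2 : discreteFourier (rootChar hη) (wordFun K c) 0 ≠ 0 := by
      intro h0
      apply wordFun_ne_zero (K := K) hc0
      ext x
      exact (mul_eq_zero.mp ((h1 x).trans h0)).resolve_left hnK
    have h3 : suppFinset (wordFun K c) = Finset.univ := by
      ext x
      simp only [mem_suppFinset, Finset.mem_univ, iff_true]
      exact right_ne_zero_of_mul ((h1 x).trans_ne h2)
    rw [h3, Finset.card_univ, ZMod.card]
  have h1 := one_mem_seqCode hη hS (Finset.mem_singleton_self 0)
  have hne : (1 : Fin n → F) ≠ 0 := by
    intro h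
    exact one_ne_zero (congrFun h ⟨0, NeZero.pos n⟩)
  constructor
  · refine ⟨1, h1, hne, ?_⟩
    rw [hammingNorm_eq_card_suppFinset (K := K), hfull 1 h1 hne]
  · rintro w ⟨c, hc, hc0, hw⟩
    rw [hammingNorm_eq_card_suppFinset (K := K), hfull c hc hc0] at hw
    exact hw.le

/-- The square root bound for the codes whose zeros contain all nonsquares. -/
lemma minWeightGE_sqrt (hn : n % 8 = 1) (hg : Subgroup.zpowers g = ⊤) {η : K}
    (hη : IsPrimitiveRoot η n) (hnK : (n : K) ≠ 0)
    (h02 : quarticPeriod g (rootChar hη) 0 + quarticPeriod g (rootChar hη) 2 = 0)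
    {s : ℕ → F} {b : Bool} {T : Finset (ZMod 4)} (hT : 1 ∉ T ∧ 3 ∉ T)
    (hS : ∀ j, j ∈ classUnion g b T ↔
      ((seqPoly n s).map (algebraMap F K)).eval (η ^ j.val) = 0)
    (hC : seqCode n s ≠ ⊥) : MinWeightGE (seqCode n s) (Real.sqrt n) := by
  classical
  refine minWeightGE_of_forall hC fun c hc hc0 => sqrt_le_of_le_sq ?_
  rw [hammingNorm_eq_card_suppFinset (K := K)]
  refine card_le_sq_of_nonsquare_zeros hn hg (rootChar_isPrimitive hη) hnK ?_
    (wordFun_ne_zero hc0) ?_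
  -- With the chosen `η` the Gauss sum is `0 - (-1) = 1`.
  · rw [sum_quadSign, h02,
      (quarticPeriod_products hn hg (rootChar_isPrimitive hη) h02).1]
    simp
  · intro j hj hsign
    rw [mem_seqCode_iff_discreteFourier hη hS] at hc
    apply hc
    rw [mem_classUnion, if_neg hj]
    intro hmem
    have : ∀ k, signIndex k = -1 → k = 1 ∨ k = 3 := by decide
    rcases this _ hsign with h | h <;> rw [h] at hmem
    · exact hT.1 hmem
    · exact hT.2 hmem

/-- `T` indexes the nonzeros of the code. Multiplication by `g ^ 2` shifts indices by 2, so the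
condition on `T` supplies the multiplier for the square root bound; the all-ones word is odd-like.
-/
lemma minOddLikeWeightGE_sqrt (hn : n % 8 = 1) (hg : Subgroup.zpowers g = ⊤) {η : K}
    (hη : IsPrimitiveRoot η n) (hnF : (n : F) ≠ 0) {s : ℕ → F} {T : Finset (ZMod 4)}
    (hT : ∀ k, k ∉ T ∨ 2 + k ∉ T)
    (hS : ∀ j, j ∈ classUnion g true T ↔
      ((seqPoly n s).map (algebraMap F K)).eval (η ^ j.val) = 0) :
    MinOddLikeWeightGE (seqCode n s) (Real.sqrt n) := by
  classical
  refine minOddLikeWeightGE_of_forall ⟨1, one_mem_seqCode hη hS ?_, ?_⟩ ?_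
  · rw [mem_classUnion, if_pos rfl]
  · simpa using hnF
  · intro c hc hc0
    apply sqrt_le_of_le_sq
    rw [hammingNorm_eq_card_suppFinset (K := K)]
    rw [mem_seqCode_iff_discreteFourier hη hS] at hc
    have hg0 : (g : ZMod n) ≠ 0 := Units.ne_zero g
    refine card_le_sq_of_sum_ne_zero (rootChar_isPrimitive hη) ((g : ZMod n) ^ 2) ?_ ?_
    · intro j hj
      rcases hT (quarticIndex g j) with h | h
      · rw [hc j, zero_mul]
        rw [mem_classUnion, if_neg hj]
        exact h
      · rw [hc ((g : ZMod n) ^ 2 * j), mul_zero]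
        rw [mem_classUnion, if_neg (mul_ne_zero (pow_ne_zero 2 hg0) hj),
          quarticIndex_mul hn hg (pow_ne_zero 2 hg0) hj, quarticIndex_pow hn hg]
        exact h
    · rw [sum_wordFun, Ne, map_eq_zero]
      exact hc0

/-- The splitting consists of the classes outside and inside `T`, interchanged by `g ^ 2`.
Multiplication by the field size preserves each class because that size lies in `C_0`. -/
lemma isDuadicCode_of_classUnion [Fintype F] (hn : n % 8 = 1) (hg : Subgroup.zpowers g = ⊤) {η : K}
    (hη : IsPrimitiveRoot η n)
    (hq : ((Fintype.card F : ℕ) : ZMod n) ∈ cyclotomicClass 4 g 0)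
    {s : ℕ → F} {T : Finset (ZMod 4)} (hT : ∀ k, k ∈ T ↔ 2 + k ∉ T)
    (hS : ∀ j, j ∈ classUnion g true T ↔
      ((seqPoly n s).map (algebraMap F K)).eval (η ^ j.val) = 0) :
    IsDuadicCode η (seqCode n s) := by
  classical
  rw [cyclotomicClass_eq hn hg, mem_quarticClass, Nat.cast_zero] at hq
  have hg0 : (g : ZMod n) ≠ 0 := Units.ne_zero g
  have hmem : ∀ (T : Finset (ZMod 4)) (x : ZMod n),
      x ∈ classUnion g false T ↔ x ≠ 0 ∧ quarticIndex g x ∈ T := by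
    intro T x
    rw [mem_classUnion]
    split_ifs with h <;> simp [h]
  have himage : ∀ T T' : Finset (ZMod 4), (∀ k, k ∈ T' ↔ 2 + k ∈ T) →
      (classUnion g false T).image (fun s => ((g ^ 2 : (ZMod n)ˣ) : ZMod n) * s) =
        classUnion g false T' := by
    intro T T' hTT'
    have hg2 : (g : ZMod n) ^ 2 ≠ 0 := pow_ne_zero 2 hg0
    ext x
    rw [Finset.mem_image, hmem]
    constructor
    · rintro ⟨y, hy, rfl⟩
      rw [hmem] at hy
      rw [Units.val_pow_eq_pow_val, quarticIndex_mul hn hg hg2 hy.1, quarticIndex_pow hn hg, hTT']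
      refine ⟨mul_ne_zero hg2 hy.1, ?_⟩
      rw [← add_assoc, show (2 + ((2 : ℕ) : ZMod 4)) = 0 from rfl, zero_add]
      exact hy.2
    · rintro ⟨hx, hxT⟩
      refine ⟨((g : ZMod n) ^ 2)⁻¹ * x, ?_, ?_⟩
      · rw [hmem, quarticIndex_mul hn hg (inv_ne_zero hg2) hx, quarticIndex_inv hn hg hg2,
          quarticIndex_pow hn hg]
        exact ⟨mul_ne_zero (inv_ne_zero hg2) hx, (hTT' _).mp hxT⟩
      · rw [Units.val_pow_eq_pow_val, mul_inv_cancel_left₀ hg2]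
  have hqmem : ∀ (T : Finset (ZMod 4)), ∀ x ∈ classUnion g false T,
      ((Fintype.card F : ℕ) : ZMod n) * x ∈ classUnion g false T := by
    intro T x hx
    rw [hmem] at *
    rw [quarticIndex_mul hn hg hq.1 hx.1, hq.2, zero_add]
    exact ⟨mul_ne_zero hq.1 hx.1, hx.2⟩
  refine ⟨classUnion g false Tᶜ, classUnion g false T, ?_, ?_, hqmem _, hqmem _,
    ⟨g ^ 2, himage _ _ ?_, himage _ _ ?_⟩, Or.inl ?_⟩
  · ext x
    rw [Finset.mem_union, hmem, hmem, Finset.mem_compl, Finset.mem_erase]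
    have := Finset.mem_univ x
    tauto
  · rw [Finset.disjoint_left]
    intro x hx hx'
    rw [hmem] at hx hx'
    exact (Finset.mem_compl.mp hx.2) hx'.2
  · intro k
    rw [Finset.mem_compl]
    exact hT k
  · intro k
    rw [Finset.mem_compl, hT k, not_not]
  · have := hasDefiningSet_seqCode hη _ hS
    rwa [compl_classUnion] at this

lemma isSquare_iff_signIndex (hn : n % 8 = 1) (hg : Subgroup.zpowers g = ⊤) {x : ZMod n}
    (hx : x ≠ 0) : IsSquare x ↔ signIndex (quarticIndex g x) = 1 := by
  constructor
  · rintro ⟨y, rfl⟩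
    have hy : y ≠ 0 := left_ne_zero_of_mul hx
    rw [quarticIndex_mul hn hg hy hy, signIndex_add]
    rcases signIndex_eq (quarticIndex g y) with h | h <;> rw [h] <;> norm_num
  · obtain ⟨m, rfl⟩ := exists_eq_pow hg hx
    rw [quarticIndex_pow hn hg]
    rcases Nat.even_or_odd m with hm | hm
    · exact fun _ => hm.isSquare_pow _
    · obtain ⟨c, rfl⟩ := hm
      intro h
      rw [Nat.cast_add, Nat.cast_mul, Nat.cast_one] at h
      have : ∀ c : ZMod 4, signIndex (((2 : ℕ) : ZMod 4) * c + 1) ≠ 1 := by decide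
      exact absurd h (this _)

lemma isQuadraticResidueCode_of_classUnion (hn : n % 8 = 1) (hg : Subgroup.zpowers g = ⊤) {η : K}
    (hη : IsPrimitiveRoot η n) {s : ℕ → F}
    (hS : ∀ j, j ∈ classUnion g true {0, 2} ↔
      ((seqPoly n s).map (algebraMap F K)).eval (η ^ j.val) = 0) :
    IsQuadraticResidueCode η (seqCode n s) := by
  classical
  -- The complement of the nonzeros is exactly the nonsquares: 0 counts as a square, and 0 is a
  -- nonzero of the code.
  refine ⟨_, Or.inr rfl, Or.inl ?_⟩
  have := hasDefiningSet_seqCode hη _ hS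
  convert this using 1
  ext x
  rw [compl_classUnion, mem_classUnion, Finset.mem_filter]
  by_cases hx : x = 0
  · simp [hx]
  · rw [if_neg hx, isSquare_iff_signIndex hn hg hx]
    have : ∀ k, ¬ signIndex k = 1 ↔ k ∈ ({0, 2} : Finset (ZMod 4))ᶜ := by decide
    simpa using this _

end Bridge

/-! ### Nonpositivity of the two numerical bounds. -/

section Bounds

lemma mul_lt_pow_of_three_le {q m : ℕ} (hq : 3 ≤ q) (hm : 5 ≤ m) :
    (8 * m + 1) * (q - 1) + 1 ≤ q ^ m := by
  obtain ⟨a, rfl⟩ := Nat.exists_eq_add_of_le' (show 1 ≤ q by omega)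
  rw [Nat.add_sub_cancel]
  induction m, hm using Nat.le_induction with
  | base =>
    have h1 : 81 ≤ (a + 1) ^ 4 := Nat.pow_le_pow_left hq 4
    have h2 : (a + 1) ^ 5 = (a + 1) ^ 4 * (a + 1) := pow_succ _ _
    nlinarith
  | succ m hm ih =>
    have h2 : (a + 1) ^ (m + 1) = (a + 1) ^ m * (a + 1) := pow_succ _ _
    have h3 : (a + 1) ^ m * 3 ≤ (a + 1) ^ m * (a + 1) := Nat.mul_le_mul_left _ hq
    nlinarith

lemma mul_lt_two_pow {m : ℕ} (hm : 6 ≤ m) : 8 * m + 1 + 1 ≤ 2 ^ m := by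
  induction m, hm using Nat.le_induction with
  | base => norm_num
  | succ m hm ih => rw [pow_succ]; omega

/-- The right side is `√r`. Apart from 17 the smallest prime `≡ 1 mod 8` is 41, from where
exponential growth wins. -/
lemma mul_card_lt_pow {n q : ℕ} (hp : n.Prime) (hn : n % 8 = 1) (h17 : n ≠ 17) (hq : 2 ≤ q)
    (hord : (q : ZMod n) ^ ((n - 1) / 4) = 1) : n * (q - 1) + 1 ≤ q ^ ((n - 1) / 8) := by
  obtain ⟨m, rfl⟩ : ∃ m, n = 8 * m + 1 := ⟨n / 8, by omega⟩
  rw [show (8 * m + 1 - 1) / 8 = m by omega]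
  have hm : 5 ≤ m := by
    by_contra h
    have : m < 5 := by omega
    interval_cases m <;> revert hp h17 <;> norm_num
  rcases Nat.lt_or_ge q 3 with hq3 | hq3
  · obtain rfl : q = 2 := by omega
    have hm6 : 6 ≤ m := by
      by_contra h
      obtain rfl : m = 5 := by omega
      -- For `n = 41`, `q = 2` the inequality fails, but `2 ^ 10 = -1` modulo 41.
      exact absurd hord (by decide)
    simpa using mul_lt_two_pow hm6
  · exact mul_lt_pow_of_three_le hq3 hm

lemma sqrt_pow_quarter {n q : ℕ} (hn : n % 8 = 1) :
    ((q : ℝ) ^ ((n - 1) / 4)) = ((q : ℝ) ^ ((n - 1) / 8)) ^ 2 := by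
  rw [← pow_mul]
  congr 1
  omega

/-- For large codes the lower bound for irreducible cyclic codes is not positive. -/
lemma irreducibleBound_nonpos {n q : ℕ} (hn : n % 8 = 1) (hq : 2 ≤ q)
    (h : n * (q - 1) + 1 ≤ q ^ ((n - 1) / 8)) : irreducibleBound q n ≤ 0 := by
  obtain ⟨a, rfl⟩ := Nat.exists_eq_add_of_le' (show 1 ≤ q by omega)
  rw [Nat.add_sub_cancel] at h
  have hn0 : (0 : ℝ) < n := by exact_mod_cast (by omega : 0 < n)
  have ha : (0 : ℝ) < a := by exact_mod_cast (by omega : 0 < a)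
  simp only [irreducibleBound, sqrt_pow_quarter hn]
  have hs : ((n : ℝ) * a + 1) ≤ ((a + 1 : ℕ) : ℝ) ^ ((n - 1) / 8) := by exact_mod_cast h
  have hsnat : (((a + 1) ^ ((n - 1) / 8) : ℕ) : ℝ) = ((a + 1 : ℕ) : ℝ) ^ ((n - 1) / 8) := by
    push_cast; rfl
  rw [← hsnat] at hs ⊢
  generalize (a + 1) ^ ((n - 1) / 8) = s at hs ⊢
  have hs0 : (1 : ℝ) ≤ s := by nlinarith
  rw [Real.sqrt_sq (by linarith)]
  have hq1 : ((a + 1 : ℕ) : ℝ) - 1 = a := by push_cast; ring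
  rw [hq1]
  -- With `s = √r` and `s - 1 ≥ n a`, this makes `(N₁ - 1) s ≥ s ^ 2 = r`, so the numerator under
  -- the ceiling is nonpositive.
  have hN1 : (s : ℝ) + 1 ≤ ((s : ℝ) ^ 2 - 1) / n / a := by
    rw [div_div, le_div_iff₀ (mul_pos hn0 ha)]
    nlinarith
  have hfloor : ((s : ℝ) ^ 2) ≤ (⌊(((s : ℝ) ^ 2 - 1) / n / a - 1) * s⌋ : ℝ) := by
    have : ((s : ℤ) ^ 2) ≤ ⌊(((s : ℝ) ^ 2 - 1) / n / a - 1) * s⌋ := by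
      rw [Int.le_floor]
      push_cast
      nlinarith
    exact_mod_cast this
  refine mul_nonpos_of_nonneg_of_nonpos ha.le ?_
  have hceil : ⌈((s : ℝ) ^ 2 - (⌊(((s : ℝ) ^ 2 - 1) / n / a - 1) * s⌋ : ℝ)) /
      (((a + 1 : ℕ) : ℝ) * (((s : ℝ) ^ 2 - 1) / n))⌉ ≤ 0 := by
    rw [Int.ceil_le, Int.cast_zero]
    refine div_nonpos_of_nonpos_of_nonneg (by linarith) ?_
    have : 0 ≤ ((s : ℝ) ^ 2 - 1) := by nlinarith
    positivity
  exact_mod_cast hceil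

/-- For large codes the lower bound for augmented irreducible cyclic codes is not positive. -/
lemma augmentedBound_nonpos {n q : ℕ} (hn : n % 8 = 1) (hq : 2 ≤ q)
    (h : n * (q - 1) + 1 ≤ q ^ ((n - 1) / 8)) : augmentedBound q n ≤ 0 := by
  obtain ⟨a, rfl⟩ := Nat.exists_eq_add_of_le' (show 1 ≤ q by omega)
  rw [Nat.add_sub_cancel] at h
  have hn1 : (1 : ℝ) ≤ n := by exact_mod_cast (by omega : 1 ≤ n)
  have ha : (1 : ℝ) ≤ a := by exact_mod_cast (by omega : 1 ≤ a)
  simp only [augmentedBound, sqrt_pow_quarter hn]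
  have hs : ((n : ℝ) * a + 1) ≤ ((a + 1 : ℕ) : ℝ) ^ ((n - 1) / 8) := by exact_mod_cast h
  have hsnat : (((a + 1) ^ ((n - 1) / 8) : ℕ) : ℝ) = ((a + 1 : ℕ) : ℝ) ^ ((n - 1) / 8) := by
    push_cast; rfl
  rw [← hsnat] at hs ⊢
  generalize (a + 1) ^ ((n - 1) / 8) = s at hs ⊢
  have hs1 : (n : ℝ) + 1 ≤ s := by nlinarith
  rw [Real.sqrt_sq (by linarith)]
  have hq1 : ((a + 1 : ℕ) : ℝ) - 1 = a := by push_cast; ring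
  have hq0 : (0 : ℝ) < ((a + 1 : ℕ) : ℝ) := by positivity
  rw [hq1]
  generalize ((a + 1 : ℕ) : ℝ) = q at *
  have hr : 0 < (s : ℝ) ^ 2 - 1 := by nlinarith
  have hn0 : (0 : ℝ) < n := by linarith
  -- `N ≥ s` gives `(N - 1) s / N ≥ s - 1 ≥ n`, while the first term of the bound is at most `(a /
  -- q) n`.
  have hfloor : (n : ℝ) ≤ (⌊(((s : ℝ) ^ 2 - 1) / n - 1) * s / (((s : ℝ) ^ 2 - 1) / n)⌋ : ℝ) := by
    have : (n : ℤ) ≤ ⌊(((s : ℝ) ^ 2 - 1) / n - 1) * s / (((s : ℝ) ^ 2 - 1) / n)⌋ := by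
      rw [Int.le_floor, le_div_iff₀ (div_pos hr hn0)]
      push_cast
      have e1 : ((s : ℝ) ^ 2 - 1) / n * n = (s : ℝ) ^ 2 - 1 := div_mul_cancel₀ _ hn0.ne'
      generalize ((s : ℝ) ^ 2 - 1) / n = N at *
      have hN : (s : ℝ) ≤ N := by
        by_contra hlt
        push Not at hlt
        nlinarith
      nlinarith
    exact_mod_cast this
  have h1 : ((a : ℝ) * ((s : ℝ) ^ 2 - 1) - 1) / (q * (((s : ℝ) ^ 2 - 1) / n)) ≤ a / q * n := by
    rw [div_le_iff₀ (mul_pos hq0 (div_pos hr hn0))]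
    have : (a : ℝ) / q * n * (q * (((s : ℝ) ^ 2 - 1) / n)) = a * ((s : ℝ) ^ 2 - 1) := by
      field_simp
    rw [this]
    linarith
  have h2 := mul_le_mul_of_nonneg_left hfloor (show (0 : ℝ) ≤ a / q by positivity)
  linarith

lemma eq_of_seventeen {p : ℕ} (hp : p.Prime) {u v : ℤ} (huv : (17 : ℤ) = u ^ 2 + 4 * v ^ 2)
    (hu : u ≡ 1 [ZMOD 4]) (hpn : (4 : ℤ) ≡ 0 [ZMOD p]) : p = 2 ∧ u = 1 := by
  constructor
  · have h1 : p ∣ 2 ^ 2 := by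
      have := (Int.modEq_zero_iff_dvd.mp hpn)
      exact_mod_cast this
    exact (Nat.prime_dvd_prime_iff_eq hp Nat.prime_two).mp (hp.dvd_of_dvd_pow h1)
  · have h1 : u ≤ 4 := by nlinarith [sq_nonneg v]
    have h2 : -4 ≤ u := by nlinarith [sq_nonneg v]
    have h3 : v ≤ 2 := by nlinarith [sq_nonneg u]
    have h4 : -2 ≤ v := by nlinarith [sq_nonneg u]
    have h5 := hu.eq
    interval_cases u <;> first | rfl | omega | (interval_cases v <;> omega)

end Bounds

/-! ### The six cases. -/

theorem mainTheorem2 {n p : ℕ} [Fact n.Prime] (hp : p.Prime) (hn : n % 8 = 1)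
    {F K : Type*} [Field F] [Fintype F] [CharP F p] [Field K] [Algebra F K]
    (hpn : ((n : ℤ) - 1) / 4 ≡ 0 [ZMOD p])
    (u v : ℤ) (huv : (n : ℤ) = u ^ 2 + 4 * v ^ 2) (hu : u ≡ 1 [ZMOD 4])
    (g : (ZMod n)ˣ) (hg : Subgroup.zpowers g = ⊤)
    (hq : ((Fintype.card F : ℕ) : ZMod n) ∈ cyclotomicClass 4 g 0)
    (η : K) (hη : IsPrimitiveRoot η n) (hη02 : etaPeriod g η 0 + etaPeriod g η 2 = 0)
    (ρ : F) (hρ : ρ = 0 ∨ ρ = 1) :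
    -- Case 1
    ((((n : ℤ) + 1 - 2 * u) / 16 ≡ 0 [ZMOD p] ∧ ((n : ℤ) - 3 + 2 * u) / 16 ≡ 0 [ZMOD p]) →
      (etaPeriod g η 1 = 0 ∨ etaPeriod g η 1 = -1) ∧
      (etaPeriod g η 1 = 0 → ρ = 0 →
        SeqAndCodeGivenBy n (cycSeq g ρ) ((X - 1) * Omega g η 3) (n - (n + 3) / 4)) ∧
      (etaPeriod g η 1 = -1 → ρ = 0 →
        SeqAndCodeGivenBy n (cycSeq g ρ) ((X - 1) * Omega g η 1) (n - (n + 3) / 4)) ∧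
      (etaPeriod g η 1 = 0 → ρ = 1 →
        SeqAndCodeGivenBy n (cycSeq g ρ) (Omega g η 1 * Omega g η 0 * Omega g η 2)
          (n - (3 * n - 3) / 4)) ∧
      (etaPeriod g η 1 = -1 → ρ = 1 →
        SeqAndCodeGivenBy n (cycSeq g ρ) (Omega g η 3 * Omega g η 0 * Omega g η 2)
          (n - (3 * n - 3) / 4)) ∧
      (ρ = 0 → orderOf ((Fintype.card F : ℕ) : ZMod n) = (n - 1) / 4 →
        MinWeightGE (seqCode n (cycSeq g ρ)) (augmentedBound (Fintype.card F) n))) ∧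
    -- Case 2
    ((((n : ℤ) + 1 - 2 * u) / 16 ≡ 0 [ZMOD p] ∧ ¬ ((n : ℤ) - 3 + 2 * u) / 16 ≡ 0 [ZMOD p]) →
      (ρ = 0 →
        SeqAndCodeGivenBy n (cycSeq g ρ) (X - 1 : K[X]) (n - 1) ∧
        IsMinWeight (seqCode n (cycSeq g ρ)) n) ∧
      (ρ = 1 →
        SeqAndCodeGivenBy n (cycSeq g ρ) (Omega g η 0 * Omega g η 2) (n - (n - 1) / 2) ∧
        MinWeightGE (seqCode n (cycSeq g ρ)) (Real.sqrt n))) ∧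
    -- Case 3
    ((((n : ℤ) + 1 - 2 * u) / 16 ≡ 1 [ZMOD p] ∧ ((n : ℤ) - 3 + 2 * u) / 16 ≡ 0 [ZMOD p]) →
      (p ≠ 2 →
        (etaPeriod g η 0 = 1 ∨ etaPeriod g η 0 = -1) ∧
        (etaPeriod g η 1 = 0 ∨ etaPeriod g η 1 = -1) ∧
        (etaPeriod g η 0 = 1 → etaPeriod g η 1 = 0 → ρ = 0 →
          SeqAndCodeGivenBy n (cycSeq g ρ) ((X - 1) * Omega g η 3 * Omega g η 2)
            (n - (n + 1) / 2)) ∧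
        (etaPeriod g η 0 = 1 → etaPeriod g η 1 = -1 → ρ = 0 →
          SeqAndCodeGivenBy n (cycSeq g ρ) ((X - 1) * Omega g η 1 * Omega g η 2)
            (n - (n + 1) / 2)) ∧
        (etaPeriod g η 0 = -1 → etaPeriod g η 1 = 0 → ρ = 0 →
          SeqAndCodeGivenBy n (cycSeq g ρ) ((X - 1) * Omega g η 3 * Omega g η 0)
            (n - (n + 1) / 2)) ∧
        (etaPeriod g η 0 = -1 → etaPeriod g η 1 = -1 → ρ = 0 →
          SeqAndCodeGivenBy n (cycSeq g ρ) ((X - 1) * Omega g η 1 * Omega g η 0)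
            (n - (n + 1) / 2)) ∧
        (etaPeriod g η 1 = 0 → ρ = 1 →
          SeqAndCodeGivenBy n (cycSeq g ρ) (Omega g η 1) (n - (n - 1) / 4)) ∧
        (etaPeriod g η 1 = -1 → ρ = 1 →
          SeqAndCodeGivenBy n (cycSeq g ρ) (Omega g η 3) (n - (n - 1) / 4)) ∧
        (ρ = 1 → orderOf ((Fintype.card F : ℕ) : ZMod n) = (n - 1) / 4 →
          MinWeightGE (seqCode n (cycSeq g ρ)) (irreducibleBound (Fintype.card F) n)) ∧
        (ρ = 0 →
          IsDuadicCode η (seqCode n (cycSeq g ρ)) ∧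
          MinOddLikeWeightGE (seqCode n (cycSeq g ρ)) (Real.sqrt n))) ∧
      (p = 2 →
        (etaPeriod g η 1 = 0 ∨ etaPeriod g η 1 = -1) ∧
        (etaPeriod g η 1 = 0 → ρ = 0 →
          SeqAndCodeGivenBy n (cycSeq g ρ)
            ((X - 1) * Omega g η 3 * Omega g η 0 * Omega g η 2) (n - (3 * n + 1) / 4)) ∧
        (etaPeriod g η 1 = -1 → ρ = 0 →
          SeqAndCodeGivenBy n (cycSeq g ρ)
            ((X - 1) * Omega g η 1 * Omega g η 0 * Omega g η 2) (n - (3 * n + 1) / 4)) ∧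
        (etaPeriod g η 1 = 0 → ρ = 1 →
          SeqAndCodeGivenBy n (cycSeq g ρ) (Omega g η 1) (n - (n - 1) / 4)) ∧
        (etaPeriod g η 1 = -1 → ρ = 1 →
          SeqAndCodeGivenBy n (cycSeq g ρ) (Omega g η 3) (n - (n - 1) / 4)) ∧
        (ρ = 1 → orderOf ((Fintype.card F : ℕ) : ZMod n) = (n - 1) / 4 →
          MinWeightGE (seqCode n (cycSeq g ρ)) (irreducibleBound (Fintype.card F) n)))) ∧
    -- Case 4
    ((((n : ℤ) + 1 - 2 * u) / 16 ≡ 1 [ZMOD p] ∧ ¬ ((n : ℤ) - 3 + 2 * u) / 16 ≡ 0 [ZMOD p]) →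
      (p ≠ 2 →
        (etaPeriod g η 0 = 1 ∨ etaPeriod g η 0 = -1) ∧
        (etaPeriod g η 0 = 1 → ρ = 0 →
          SeqAndCodeGivenBy n (cycSeq g ρ) ((X - 1) * Omega g η 2) (n - (n + 3) / 4)) ∧
        (etaPeriod g η 0 = -1 → ρ = 0 →
          SeqAndCodeGivenBy n (cycSeq g ρ) ((X - 1) * Omega g η 0) (n - (n + 3) / 4)) ∧
        (ρ = 1 → SeqAndCodeGivenBy n (cycSeq g ρ) (1 : K[X]) n) ∧
        (ρ = 0 → orderOf ((Fintype.card F : ℕ) : ZMod n) = (n - 1) / 4 →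
          MinWeightGE (seqCode n (cycSeq g ρ)) (augmentedBound (Fintype.card F) n))) ∧
      (p = 2 →
        (ρ = 0 →
          SeqAndCodeGivenBy n (cycSeq g ρ) ((X - 1) * Omega g η 0 * Omega g η 2)
            (n - (n + 1) / 2) ∧
          IsQuadraticResidueCode η (seqCode n (cycSeq g ρ)) ∧
          MinWeightGE (seqCode n (cycSeq g ρ)) (Real.sqrt n)) ∧
        (ρ = 1 → SeqAndCodeGivenBy n (cycSeq g ρ) (1 : K[X]) n))) ∧
    -- Case 5
    ((¬ ((n : ℤ) + 1 - 2 * u) / 16 ≡ 0 [ZMOD p] ∧ ¬ ((n : ℤ) + 1 - 2 * u) / 16 ≡ 1 [ZMOD p] ∧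
        ((n : ℤ) - 3 + 2 * u) / 16 ≡ 0 [ZMOD p]) →
      (etaPeriod g η 1 = 0 ∨ etaPeriod g η 1 = -1) ∧
      (etaPeriod g η 1 = 0 → ρ = 0 →
        SeqAndCodeGivenBy n (cycSeq g ρ) ((X - 1) * Omega g η 3) (n - (n + 3) / 4)) ∧
      (etaPeriod g η 1 = -1 → ρ = 0 →
        SeqAndCodeGivenBy n (cycSeq g ρ) ((X - 1) * Omega g η 1) (n - (n + 3) / 4)) ∧
      (etaPeriod g η 1 = 0 → ρ = 1 →
        SeqAndCodeGivenBy n (cycSeq g ρ) (Omega g η 1) (n - (n - 1) / 4)) ∧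
      (etaPeriod g η 1 = -1 → ρ = 1 →
        SeqAndCodeGivenBy n (cycSeq g ρ) (Omega g η 3) (n - (n - 1) / 4)) ∧
      (ρ = 0 → orderOf ((Fintype.card F : ℕ) : ZMod n) = (n - 1) / 4 →
        MinWeightGE (seqCode n (cycSeq g ρ)) (augmentedBound (Fintype.card F) n)) ∧
      (ρ = 1 → orderOf ((Fintype.card F : ℕ) : ZMod n) = (n - 1) / 4 →
        MinWeightGE (seqCode n (cycSeq g ρ)) (irreducibleBound (Fintype.card F) n))) ∧
    -- Case 6
    ((¬ ((n : ℤ) + 1 - 2 * u) / 16 ≡ 0 [ZMOD p] ∧ ¬ ((n : ℤ) + 1 - 2 * u) / 16 ≡ 1 [ZMOD p] ∧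
        ¬ ((n : ℤ) - 3 + 2 * u) / 16 ≡ 0 [ZMOD p]) →
      (ρ = 0 →
        SeqAndCodeGivenBy n (cycSeq g ρ) (X - 1 : K[X]) (n - 1) ∧
        IsMinWeight (seqCode n (cycSeq g ρ)) n) ∧
      (ρ = 1 → SeqAndCodeGivenBy n (cycSeq g ρ) (1 : K[X]) n)) := by
  classical
  set ψ := rootChar hη with hψ
  have hprim : ψ.IsPrimitive := rootChar_isPrimitive hη
  have e0 : etaPeriod g η 0 = quarticPeriod g ψ 0 := by simpa using etaPeriod_eq hn hg hη 0
  have e1 : etaPeriod g η 1 = quarticPeriod g ψ 1 := by simpa using etaPeriod_eq hn hg hη 1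
  have e2 : etaPeriod g η 2 = quarticPeriod g ψ 2 := by simpa using etaPeriod_eq hn hg hη 2
  rw [e0, e2] at hη02
  rw [e0, e1]
  have hn1 : 1 < n := (Fact.out : n.Prime).one_lt
  have hneg1 : (-1 : K) ≠ 0 := neg_ne_zero.mpr one_ne_zero
  have : CharP K p := charP_of_injective_algebraMap (algebraMap F K).injective p
  obtain ⟨h13, hp02, hp13⟩ := quarticPeriod_products hn hg hprim hη02
  obtain ⟨hC, hE⟩ := cyclotomicNumber_zero_two hn hg huv hu
  have hE' : ((n : ℤ) + 1 - 2 * u) / 16 = (cyclotomicNumber g 1 3 : ℤ) := by omega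
  have hC' : ((n : ℤ) - 3 + 2 * u) / 16 = (cyclotomicNumber g 0 2 : ℤ) := by omega
  have hfF : (((n - 1) / 4 : ℕ) : F) = 0 := by
    rw [← Int.cast_natCast, ← Int.cast_zero, CharP.intCast_eq_intCast F p,
      show (((n - 1) / 4 : ℕ) : ℤ) = ((n : ℤ) - 1) / 4 by omega]
    exact hpn
  have hf : (((n - 1) / 4 : ℕ) : K) = 0 := by
    rw [← map_natCast (algebraMap F K), hfF, map_zero]
  have hnF : (n : F) ≠ 0 := by
    rw [show n = 4 * ((n - 1) / 4) + 1 by omega, Nat.cast_add, Nat.cast_mul, hfF]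
    simp
  have hnK : (n : K) ≠ 0 := by
    rw [← map_natCast (algebraMap F K)]
    exact (_root_.map_ne_zero _).mpr hnF
  -- `K` has characteristic `p`, so congruences for `E` and `C` become equations between periods;
  -- `η_2 = -η_0` turns the product into a square.
  have hEiff : ∀ a : ℤ, ((n : ℤ) + 1 - 2 * u) / 16 ≡ a [ZMOD p] ↔
      quarticPeriod g ψ 0 ^ 2 = (a : K) := by
    intro a
    rw [hE', ← CharP.intCast_eq_intCast K p, Int.cast_natCast]
    have : quarticPeriod g ψ 0 ^ 2 = (cyclotomicNumber g 1 3 : K) := by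
      linear_combination quarticPeriod g ψ 0 * hη02 - hp02
    rw [this]
  have hCiff : ((n : ℤ) - 3 + 2 * u) / 16 ≡ 0 [ZMOD p] ↔
      quarticPeriod g ψ 1 * quarticPeriod g ψ 3 = 0 := by
    rw [hC', ← CharP.intCast_eq_intCast K p, Int.cast_natCast, Int.cast_zero, hp13, neg_eq_zero]
  have bounds : (n ≠ 17) → orderOf ((Fintype.card F : ℕ) : ZMod n) = (n - 1) / 4 →
      irreducibleBound (Fintype.card F) n ≤ 0 ∧ augmentedBound (Fintype.card F) n ≤ 0 := by
    intro h17 hord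
    have hq2 : 2 ≤ Fintype.card F := Fintype.one_lt_card
    have h := mul_card_lt_pow (n := n) Fact.out hn h17 hq2
      (by rw [← hord]; exact pow_orderOf_eq_one _)
    exact ⟨irreducibleBound_nonpos hn hq2 h, augmentedBound_nonpos hn hq2 h⟩
  -- So `n = 17` occurs only with `p = 2`, `E = C = 1`, where neither `B_1` nor `B_2` is claimed.
  have h17 : n = 17 → p = 2 ∧ ((n : ℤ) + 1 - 2 * u) / 16 = 1 ∧ ((n : ℤ) - 3 + 2 * u) / 16 = 1 := by
    intro h
    have hnz : (n : ℤ) = 17 := by exact_mod_cast h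
    rw [hnz] at huv hpn
    obtain ⟨h2, h1⟩ := eq_of_seventeen hp huv hu hpn
    rw [hnz, h1]
    exact ⟨h2, by norm_num, by norm_num⟩
  rw [hCiff, hEiff 0, hEiff 1, Int.cast_zero, Int.cast_one]
  have h17' : n = 17 → p = 2 ∧ quarticPeriod g ψ 0 ^ 2 = 1 ∧
      quarticPeriod g ψ 1 * quarticPeriod g ψ 3 ≠ 0 := by
    intro h
    obtain ⟨h2, h3, h4⟩ := h17 h
    refine ⟨h2, ?_, ?_⟩
    · rw [← Int.cast_one, ← hEiff 1, h3]
    · rw [Ne, ← hCiff, h4, h2]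
      decide
  have hS : ∀ (b : Bool) (T : Finset (ZMod 4)), (b = true ↔ ρ = 0) →
      (∀ k, k ∈ T ↔ quarticPeriod g ψ k = algebraMap F K ρ - 1) → ∀ j, j ∈ classUnion g b T ↔
      ((seqPoly n (cycSeq g ρ)).map (algebraMap F K)).eval (η ^ j.val) = 0 :=
    fun b T hb hT => mem_classUnion_iff_eval hn hg hη hf hb hT
  have zeros0 : ρ = 0 → ∀ T : Finset (ZMod 4), (0 ∈ T ↔ quarticPeriod g ψ 0 = -1) →
      (1 ∈ T ↔ quarticPeriod g ψ 1 = -1) → (2 ∈ T ↔ quarticPeriod g ψ 2 = -1) →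
      (3 ∈ T ↔ quarticPeriod g ψ 3 = -1) → ∀ j, j ∈ classUnion g true T ↔
      ((seqPoly n (cycSeq g ρ)).map (algebraMap F K)).eval (η ^ j.val) = 0 := by
    intro h T t0 t1 t2 t3
    refine hS true T (by simp [h]) fun k => ?_
    rw [h, map_zero, zero_sub]
    have : ∀ k : ZMod 4, k = 0 ∨ k = 1 ∨ k = 2 ∨ k = 3 := by decide
    rcases this k with rfl | rfl | rfl | rfl <;> assumption
  have zeros1 : ρ = 1 → ∀ T : Finset (ZMod 4), (0 ∈ T ↔ quarticPeriod g ψ 0 = 0) →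
      (1 ∈ T ↔ quarticPeriod g ψ 1 = 0) → (2 ∈ T ↔ quarticPeriod g ψ 2 = 0) →
      (3 ∈ T ↔ quarticPeriod g ψ 3 = 0) → ∀ j, j ∈ classUnion g false T ↔
      ((seqPoly n (cycSeq g ρ)).map (algebraMap F K)).eval (η ^ j.val) = 0 := by
    intro h T t0 t1 t2 t3
    refine hS false T (by simp [h]) fun k => ?_
    rw [h, map_one, sub_self]
    have : ∀ k : ZMod 4, k = 0 ∨ k = 1 ∨ k = 2 ∨ k = 3 := by decide
    rcases this k with rfl | rfl | rfl | rfl <;> assumption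
  have given : ∀ {b : Bool} {T : Finset (ZMod 4)} {t : ℕ} {D : K[X]} {L : ℕ},
      (∀ j, j ∈ classUnion g b T ↔
        ((seqPoly n (cycSeq g ρ)).map (algebraMap F K)).eval (η ^ j.val) = 0) →
      T.card = t → (if b = true then X - 1 else 1) * ∏ k ∈ T, Omega g η k.val = D →
      L = n - ((if b = true then 1 else 0) + t * ((n - 1) / 4)) →
      SeqAndCodeGivenBy n (cycSeq g ρ) D L := by
    intro b T t D L hz ht hD hL
    have := seqAndCodeGivenBy_of_roots hη (cycSeq_periodic ρ) _ hz
    rwa [prod_classUnion_eq_Omega hn hg, card_classUnion hn hg, hD, ht, ← hL] at this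
  have given0 : ∀ {T : Finset (ZMod 4)} {t : ℕ} {D : K[X]} {L : ℕ},
      (∀ j, j ∈ classUnion g true T ↔
        ((seqPoly n (cycSeq g ρ)).map (algebraMap F K)).eval (η ^ j.val) = 0) →
      T.card = t → (X - 1) * ∏ k ∈ T, Omega g η k.val = D → L = n - (1 + t * ((n - 1) / 4)) →
      SeqAndCodeGivenBy n (cycSeq g ρ) D L :=
    fun hz ht hD hL => given hz ht (by rwa [if_pos rfl]) (by rwa [if_pos rfl])
  have given1 : ∀ {T : Finset (ZMod 4)} {t : ℕ} {D : K[X]} {L : ℕ},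
      (∀ j, j ∈ classUnion g false T ↔
        ((seqPoly n (cycSeq g ρ)).map (algebraMap F K)).eval (η ^ j.val) = 0) →
      T.card = t → ∏ k ∈ T, Omega g η k.val = D → L = n - t * ((n - 1) / 4) →
      SeqAndCodeGivenBy n (cycSeq g ρ) D L :=
    fun hz ht hD hL => given hz ht (by simpa using hD) (by simpa using hL)
  -- A minimum weight exists only for a nonzero code; here the all-ones word belongs to it.
  have nonbot0 : ρ = 0 → seqCode n (cycSeq g ρ) ≠ ⊥ := by
    intro h hbot
    have h1 : (1 : Fin n → F) ∈ seqCode n (cycSeq g ρ) := by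
      refine one_mem_seqCode hη (hS true (Finset.univ.filter fun k =>
        quarticPeriod g ψ k = algebraMap F K ρ - 1) (by simp [h]) (by simp)) ?_
      rw [mem_classUnion, if_pos rfl]
    rw [hbot, Submodule.mem_bot] at h1
    exact one_ne_zero (congrFun h1 ⟨0, NeZero.pos n⟩)
  have augmented : n ≠ 17 → ρ = 0 → orderOf ((Fintype.card F : ℕ) : ZMod n) = (n - 1) / 4 →
      MinWeightGE (seqCode n (cycSeq g ρ)) (augmentedBound (Fintype.card F) n) :=
    fun hne hρ0 hord => minWeightGE_of_forall (nonbot0 hρ0) fun c _ _ =>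
      (bounds hne hord).2.trans (Nat.cast_nonneg _)
  have irreducible : n ≠ 17 → seqCode n (cycSeq g ρ) ≠ ⊥ →
      orderOf ((Fintype.card F : ℕ) : ZMod n) = (n - 1) / 4 →
      MinWeightGE (seqCode n (cycSeq g ρ)) (irreducibleBound (Fintype.card F) n) :=
    fun hne hbot hord => minWeightGE_of_forall hbot fun c _ _ =>
      (bounds hne hord).1.trans (Nat.cast_nonneg _)
  have zeroE : quarticPeriod g ψ 0 ^ 2 = 0 → quarticPeriod g ψ 0 = 0 ∧ quarticPeriod g ψ 2 = 0 := by
    intro h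
    have h0 := pow_eq_zero_iff (two_ne_zero) |>.mp h
    exact ⟨h0, by rw [h0, zero_add] at hη02; exact hη02⟩
  have oneE : quarticPeriod g ψ 0 ^ 2 = 1 → quarticPeriod g ψ 0 = 1 ∨ quarticPeriod g ψ 0 = -1 :=
    fun h => sq_eq_sq_iff_eq_or_eq_neg.mp (h.trans (one_pow 2).symm)
  have two_of_one : quarticPeriod g ψ 0 = 1 → quarticPeriod g ψ 2 = -1 := fun h => by
    linear_combination hη02 - h
  have two_of_neg : quarticPeriod g ψ 0 = -1 → quarticPeriod g ψ 2 = 1 := fun h => by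
    linear_combination hη02 - h
  have neE : quarticPeriod g ψ 0 ^ 2 ≠ 0 → quarticPeriod g ψ 0 ≠ 0 ∧ quarticPeriod g ψ 2 ≠ 0 :=
    fun h => ⟨fun h0 => h (by rw [h0]; ring), fun h2 => h (by
      linear_combination quarticPeriod g ψ 0 * hη02 - quarticPeriod g ψ 0 * h2)⟩
  have neE1 : quarticPeriod g ψ 0 ^ 2 ≠ 1 → quarticPeriod g ψ 0 ≠ -1 ∧ quarticPeriod g ψ 2 ≠ -1 :=
    fun h => ⟨fun h0 => h (by rw [h0]; ring), fun h2 => h (by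
      linear_combination (quarticPeriod g ψ 0 + 1) * (hη02 - h2))⟩
  have three_of_zero : quarticPeriod g ψ 1 = 0 → quarticPeriod g ψ 3 = -1 := fun h => by
    linear_combination h13 - h
  have three_of_neg : quarticPeriod g ψ 1 = -1 → quarticPeriod g ψ 3 = 0 := fun h => by
    linear_combination h13 - h
  have zeroC : quarticPeriod g ψ 1 * quarticPeriod g ψ 3 = 0 →
      quarticPeriod g ψ 1 = 0 ∨ quarticPeriod g ψ 1 = -1 := fun h =>
    (mul_eq_zero.mp h).imp id fun h3 => by linear_combination h13 - h3
  have neC : quarticPeriod g ψ 1 * quarticPeriod g ψ 3 ≠ 0 →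
      (quarticPeriod g ψ 1 ≠ 0 ∧ quarticPeriod g ψ 3 ≠ 0) ∧
      (quarticPeriod g ψ 1 ≠ -1 ∧ quarticPeriod g ψ 3 ≠ -1) := fun h =>
    ⟨⟨left_ne_zero_of_mul h, right_ne_zero_of_mul h⟩,
      fun h1 => h (by rw [three_of_neg h1, mul_zero]),
      fun h3 => h (by rw [show quarticPeriod g ψ 1 = 0 by linear_combination h13 - h3, zero_mul])⟩
  have zero_ne_neg : ∀ {a : K}, a = 0 → a ≠ -1 := fun h => h ▸ hneg1.symm
  have ne_zero_of_neg : ∀ {a : K}, a = -1 → a ≠ 0 := fun h => h ▸ hneg1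
  have one_ne_neg : p ≠ 2 → ∀ {a : K}, a = 1 → a ≠ -1 := by
    rintro hp2 a rfl h
    apply hp2
    have h2 : ((2 : ℕ) : K) = 0 := by push_cast; linear_combination h
    exact (Nat.prime_dvd_prime_iff_eq hp Nat.prime_two).mp ((CharP.cast_eq_zero_iff K p 2).mp h2)
  have two_zero : p = 2 → (2 : K) = 0 := fun h => by
    have := (CharP.cast_eq_zero_iff K p 2).mpr (h ▸ dvd_rfl)
    exact_mod_cast this
  have single : ρ = 1 → quarticPeriod g ψ 0 ≠ 0 → quarticPeriod g ψ 2 ≠ 0 →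
      (quarticPeriod g ψ 1 = 0 →
        SeqAndCodeGivenBy n (cycSeq g ρ) (Omega g η 1) (n - (n - 1) / 4)) ∧
      (quarticPeriod g ψ 1 = -1 →
        SeqAndCodeGivenBy n (cycSeq g ρ) (Omega g η 3) (n - (n - 1) / 4)) := by
    intro h b0 b2
    refine ⟨fun a1 => ?_, fun a1 => ?_⟩
    · have a3 := three_of_zero a1
      exact given1 (t := 1) (zeros1 h {1} (iff_of_false (by decide) b0) (iff_of_true (by decide) a1)
        (iff_of_false (by decide) b2) (iff_of_false (by decide) (ne_zero_of_neg a3))) rfl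
        (by rw [Finset.prod_singleton]; rfl) (by omega)
    · have a3 := three_of_neg a1
      exact given1 (t := 1) (zeros1 h {3} (iff_of_false (by decide) b0)
        (iff_of_false (by decide) (ne_zero_of_neg a1)) (iff_of_false (by decide) b2)
        (iff_of_true (by decide) a3)) rfl (by rw [Finset.prod_singleton]; rfl) (by omega)
  have irreducible_single : ρ = 1 → quarticPeriod g ψ 0 ≠ 0 → quarticPeriod g ψ 2 ≠ 0 →
      quarticPeriod g ψ 1 * quarticPeriod g ψ 3 = 0 →
      orderOf ((Fintype.card F : ℕ) : ZMod n) = (n - 1) / 4 →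
      MinWeightGE (seqCode n (cycSeq g ρ)) (irreducibleBound (Fintype.card F) n) := by
    intro h b0 b2 hC0
    refine irreducible (fun h => (h17' h).2.2 hC0) ?_
    rcases zeroC hC0 with a1 | a1
    · exact seqCode_ne_bot_of_given ((single h b0 b2).1 a1) (by omega)
    · exact seqCode_ne_bot_of_given ((single h b0 b2).2 a1) (by omega)
  -- In characteristic 2 the values `1` and `-1` coincide, so both classes 0 and 2 enter the zero
  -- set instead of just one.
  have both_neg : p = 2 → quarticPeriod g ψ 0 ^ 2 = 1 →
      quarticPeriod g ψ 0 = -1 ∧ quarticPeriod g ψ 2 = -1 := by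
    intro hp2 h
    have h2 := two_zero hp2
    rcases oneE h with a0 | a0
    · exact ⟨by linear_combination a0 + h2, two_of_one a0⟩
    · exact ⟨a0, by linear_combination two_of_neg a0 + h2⟩
  have full : ρ = 1 → quarticPeriod g ψ 0 ≠ 0 → quarticPeriod g ψ 2 ≠ 0 →
      quarticPeriod g ψ 1 * quarticPeriod g ψ 3 ≠ 0 →
      SeqAndCodeGivenBy n (cycSeq g ρ) (1 : K[X]) n := by
    intro h b0 b2 hC0
    obtain ⟨⟨b1, b3⟩, -⟩ := neC hC0
    exact given1 (t := 0) (zeros1 h ∅ (iff_of_false (by decide) b0) (iff_of_false (by decide) b1)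
      (iff_of_false (by decide) b2) (iff_of_false (by decide) b3)) rfl (by simp) (by simp)
  refine ⟨?_, ?_, ?_, ?_, ?_, ?_⟩
  · rintro ⟨hE0, hC0⟩
    obtain ⟨a0, a2⟩ := zeroE hE0
    refine ⟨zeroC hC0, fun a1 h => ?_, fun a1 h => ?_, fun a1 h => ?_, fun a1 h => ?_, augmented ?_⟩
    · have a3 := three_of_zero a1
      exact given0 (t := 1) (zeros0 h {3} (iff_of_false (by decide) (zero_ne_neg a0))
        (iff_of_false (by decide) (zero_ne_neg a1)) (iff_of_false (by decide) (zero_ne_neg a2))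
        (iff_of_true (by decide) a3)) rfl (by rw [Finset.prod_singleton]; rfl) (by omega)
    · have a3 := three_of_neg a1
      exact given0 (t := 1) (zeros0 h {1} (iff_of_false (by decide) (zero_ne_neg a0))
        (iff_of_true (by decide) a1) (iff_of_false (by decide) (zero_ne_neg a2))
        (iff_of_false (by decide) (zero_ne_neg a3))) rfl
        (by rw [Finset.prod_singleton]; rfl) (by omega)
    · have a3 := three_of_zero a1
      exact given1 (t := 3) (zeros1 h {1, 0, 2} (iff_of_true (by decide) a0)
        (iff_of_true (by decide) a1) (iff_of_true (by decide) a2)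
        (iff_of_false (by decide) (ne_zero_of_neg a3))) rfl (by
        rw [Finset.prod_insert (by decide), Finset.prod_insert (by decide), Finset.prod_singleton]
        simp only [← mul_assoc]; rfl) (by omega)
    · have a3 := three_of_neg a1
      exact given1 (t := 3) (zeros1 h {3, 0, 2} (iff_of_true (by decide) a0)
        (iff_of_false (by decide) (ne_zero_of_neg a1)) (iff_of_true (by decide) a2)
        (iff_of_true (by decide) a3)) rfl (by
        rw [Finset.prod_insert (by decide), Finset.prod_insert (by decide), Finset.prod_singleton]
        simp only [← mul_assoc]; rfl) (by omega)
    · exact fun h => (h17' h).2.2 hC0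
  · rintro ⟨hE0, hC0⟩
    obtain ⟨a0, a2⟩ := zeroE hE0
    obtain ⟨⟨b1, b3⟩, c1, c3⟩ := neC hC0
    refine ⟨fun h => ?_, fun h => ?_⟩
    · have hz := zeros0 h ∅ (iff_of_false (by decide) (zero_ne_neg a0))
        (iff_of_false (by decide) c1) (iff_of_false (by decide) (zero_ne_neg a2))
        (iff_of_false (by decide) c3)
      refine ⟨given0 (t := 0) hz rfl (by simp) (by simp), isMinWeight_repetition hη hnK ?_⟩
      rwa [show classUnion g true ∅ = {0} by ext x; simp [mem_classUnion]] at hz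
    · have hz := zeros1 h {0, 2} (iff_of_true (by decide) a0) (iff_of_false (by decide) b1)
        (iff_of_true (by decide) a2) (iff_of_false (by decide) b3)
      have hgiv : SeqAndCodeGivenBy n (cycSeq g ρ) (Omega g η 0 * Omega g η 2) (n - (n - 1) / 2) :=
        given1 (t := 2) hz rfl (by
        rw [Finset.prod_insert (by decide), Finset.prod_singleton]
        rfl) (by omega)
      exact ⟨hgiv, minWeightGE_sqrt hn hg hη hnK hη02 (by decide) hz
        (seqCode_ne_bot_of_given hgiv (by omega))⟩
  · rintro ⟨hE1, hC0⟩
    obtain ⟨b0, b2⟩ := neE (hE1.trans_ne one_ne_zero)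
    refine ⟨fun hp2 => ⟨oneE hE1, zeroC hC0, fun a0 a1 h => ?_, fun a0 a1 h => ?_,
      fun a0 a1 h => ?_, fun a0 a1 h => ?_, fun a1 h => (single h b0 b2).1 a1,
      fun a1 h => (single h b0 b2).2 a1, fun h => irreducible_single h b0 b2 hC0, fun h => ?_⟩,
      fun hp2 => ⟨zeroC hC0, fun a1 h => ?_, fun a1 h => ?_, fun a1 h => (single h b0 b2).1 a1,
      fun a1 h => (single h b0 b2).2 a1, fun h => irreducible_single h b0 b2 hC0⟩⟩
    · have a2 := two_of_one a0
      have a3 := three_of_zero a1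
      exact given0 (t := 2) (zeros0 h {3, 2} (iff_of_false (by decide) (one_ne_neg hp2 a0))
        (iff_of_false (by decide) (zero_ne_neg a1)) (iff_of_true (by decide) a2)
        (iff_of_true (by decide) a3)) rfl (by
        rw [Finset.prod_insert (by decide), Finset.prod_singleton]
        simp only [← mul_assoc]; rfl) (by omega)
    · have a2 := two_of_one a0
      have a3 := three_of_neg a1
      exact given0 (t := 2) (zeros0 h {1, 2} (iff_of_false (by decide) (one_ne_neg hp2 a0))
        (iff_of_true (by decide) a1) (iff_of_true (by decide) a2)
        (iff_of_false (by decide) (zero_ne_neg a3))) rfl (by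
        rw [Finset.prod_insert (by decide), Finset.prod_singleton]
        simp only [← mul_assoc]; rfl) (by omega)
    · have a2 := two_of_neg a0
      have a3 := three_of_zero a1
      exact given0 (t := 2) (zeros0 h {3, 0} (iff_of_true (by decide) a0)
        (iff_of_false (by decide) (zero_ne_neg a1)) (iff_of_false (by decide) (one_ne_neg hp2 a2))
        (iff_of_true (by decide) a3)) rfl (by
        rw [Finset.prod_insert (by decide), Finset.prod_singleton]
        simp only [← mul_assoc]; rfl) (by omega)
    · have a2 := two_of_neg a0
      have a3 := three_of_neg a1
      exact given0 (t := 2) (zeros0 h {1, 0} (iff_of_true (by decide) a0)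
        (iff_of_true (by decide) a1) (iff_of_false (by decide) (one_ne_neg hp2 a2))
        (iff_of_false (by decide) (zero_ne_neg a3))) rfl (by
        rw [Finset.prod_insert (by decide), Finset.prod_singleton]
        simp only [← mul_assoc]; rfl) (by omega)
    -- Exactly one of each pair `η_0, η_2` and `η_1, η_3` equals `-1`, so `T` meets each pair of
    -- opposite indices once.
    · have duadic : ∀ T : Finset (ZMod 4), (∀ k, k ∈ T ↔ 2 + k ∉ T) →
          (∀ j, j ∈ classUnion g true T ↔
            ((seqPoly n (cycSeq g ρ)).map (algebraMap F K)).eval (η ^ j.val) = 0) →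
          IsDuadicCode η (seqCode n (cycSeq g ρ)) ∧
            MinOddLikeWeightGE (seqCode n (cycSeq g ρ)) (Real.sqrt n) := fun T hT hz =>
        ⟨isDuadicCode_of_classUnion hn hg hη hq hT hz,
          minOddLikeWeightGE_sqrt hn hg hη hnF
            (fun k => (Classical.em (k ∈ T)).symm.imp id (hT k).mp) hz⟩
      rcases oneE hE1 with a0 | a0 <;> rcases zeroC hC0 with a1 | a1
      · have a2 := two_of_one a0
        have a3 := three_of_zero a1
        exact duadic {3, 2} (by decide) (zeros0 h _ (iff_of_false (by decide) (one_ne_neg hp2 a0))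
          (iff_of_false (by decide) (zero_ne_neg a1)) (iff_of_true (by decide) a2)
          (iff_of_true (by decide) a3))
      · have a2 := two_of_one a0
        have a3 := three_of_neg a1
        exact duadic {1, 2} (by decide) (zeros0 h _ (iff_of_false (by decide) (one_ne_neg hp2 a0))
          (iff_of_true (by decide) a1) (iff_of_true (by decide) a2)
          (iff_of_false (by decide) (zero_ne_neg a3)))
      · have a2 := two_of_neg a0
        have a3 := three_of_zero a1
        exact duadic {3, 0} (by decide) (zeros0 h _ (iff_of_true (by decide) a0)
          (iff_of_false (by decide) (zero_ne_neg a1)) (iff_of_false (by decide) (one_ne_neg hp2 a2))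
          (iff_of_true (by decide) a3))
      · have a2 := two_of_neg a0
        have a3 := three_of_neg a1
        exact duadic {1, 0} (by decide) (zeros0 h _ (iff_of_true (by decide) a0)
          (iff_of_true (by decide) a1) (iff_of_false (by decide) (one_ne_neg hp2 a2))
          (iff_of_false (by decide) (zero_ne_neg a3)))
    · obtain ⟨a0, a2⟩ := both_neg hp2 hE1
      have a3 := three_of_zero a1
      exact given0 (t := 3) (zeros0 h {3, 0, 2} (iff_of_true (by decide) a0)
        (iff_of_false (by decide) (zero_ne_neg a1)) (iff_of_true (by decide) a2)
        (iff_of_true (by decide) a3)) rfl (by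
        rw [Finset.prod_insert (by decide), Finset.prod_insert (by decide), Finset.prod_singleton]
        simp only [← mul_assoc]; rfl) (by omega)
    · obtain ⟨a0, a2⟩ := both_neg hp2 hE1
      have a3 := three_of_neg a1
      exact given0 (t := 3) (zeros0 h {1, 0, 2} (iff_of_true (by decide) a0)
        (iff_of_true (by decide) a1) (iff_of_true (by decide) a2)
        (iff_of_false (by decide) (zero_ne_neg a3))) rfl (by
        rw [Finset.prod_insert (by decide), Finset.prod_insert (by decide), Finset.prod_singleton]
        simp only [← mul_assoc]; rfl) (by omega)
  · rintro ⟨hE1, hC0⟩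
    obtain ⟨b0, b2⟩ := neE (hE1.trans_ne one_ne_zero)
    obtain ⟨-, c1, c3⟩ := neC hC0
    refine ⟨fun hp2 => ⟨oneE hE1, fun a0 h => ?_, fun a0 h => ?_, fun h => full h b0 b2 hC0,
      augmented fun h => hp2 (h17' h).1⟩, fun hp2 => ⟨fun h => ?_, fun h => full h b0 b2 hC0⟩⟩
    · have a2 := two_of_one a0
      exact given0 (t := 1) (zeros0 h {2} (iff_of_false (by decide) (one_ne_neg hp2 a0))
        (iff_of_false (by decide) c1) (iff_of_true (by decide) a2) (iff_of_false (by decide) c3))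
        rfl (by rw [Finset.prod_singleton]; rfl) (by omega)
    · have a2 := two_of_neg a0
      exact given0 (t := 1) (zeros0 h {0} (iff_of_true (by decide) a0) (iff_of_false (by decide) c1)
        (iff_of_false (by decide) (one_ne_neg hp2 a2)) (iff_of_false (by decide) c3)) rfl
        (by rw [Finset.prod_singleton]; rfl) (by omega)
    · obtain ⟨a0, a2⟩ := both_neg hp2 hE1
      have hz := zeros0 h {0, 2} (iff_of_true (by decide) a0) (iff_of_false (by decide) c1)
        (iff_of_true (by decide) a2) (iff_of_false (by decide) c3)
      refine ⟨given0 (t := 2) hz rfl (by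
        rw [Finset.prod_insert (by decide), Finset.prod_singleton]
        simp only [← mul_assoc]; rfl)
        (by omega),
        isQuadraticResidueCode_of_classUnion hn hg hη hz,
        minWeightGE_sqrt hn hg hη hnK hη02 (by decide) hz (nonbot0 h)⟩
  · rintro ⟨hE0, hE1, hC0⟩
    obtain ⟨b0, b2⟩ := neE hE0
    obtain ⟨c0, c2⟩ := neE1 hE1
    refine ⟨zeroC hC0, fun a1 h => ?_, fun a1 h => ?_, fun a1 h => (single h b0 b2).1 a1,
      fun a1 h => (single h b0 b2).2 a1, augmented fun h => (h17' h).2.2 hC0,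
      fun h => irreducible_single h b0 b2 hC0⟩
    · have a3 := three_of_zero a1
      exact given0 (t := 1) (zeros0 h {3} (iff_of_false (by decide) c0)
        (iff_of_false (by decide) (zero_ne_neg a1)) (iff_of_false (by decide) c2)
        (iff_of_true (by decide) a3)) rfl (by rw [Finset.prod_singleton]; rfl) (by omega)
    · have a3 := three_of_neg a1
      exact given0 (t := 1) (zeros0 h {1} (iff_of_false (by decide) c0) (iff_of_true (by decide) a1)
        (iff_of_false (by decide) c2) (iff_of_false (by decide) (zero_ne_neg a3))) rfl
        (by rw [Finset.prod_singleton]; rfl) (by omega)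
  · rintro ⟨hE0, hE1, hC0⟩
    obtain ⟨b0, b2⟩ := neE hE0
    obtain ⟨c0, c2⟩ := neE1 hE1
    obtain ⟨-, c1, c3⟩ := neC hC0
    refine ⟨fun h => ?_, fun h => full h b0 b2 hC0⟩
    · have hz := zeros0 h ∅ (iff_of_false (by decide) c0) (iff_of_false (by decide) c1)
        (iff_of_false (by decide) c2) (iff_of_false (by decide) c3)
      refine ⟨given0 (t := 0) hz rfl (by simp) (by simp), isMinWeight_repetition hη hnK ?_⟩
      rwa [show classUnion g true ∅ = {0} by ext x; simp [mem_classUnion]] at hz
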